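/- A finite tree is a finite partially ordered set $T$ such that for every $\omega\in T$ the set $\{\alpha\in T:\alpha\ge\omega\}$ is totally ordered (several maximal elements are allowed). A $3$-tree is a cartesian product $T^3=T_1\times T_2\times T_3$ of three (possibly different) finite trees with the product order. For $\psi:T^3\to\mathbb R$ put $\mathbf I^*\psi(\gamma)=\sum_{\gamma'\le\gamma}\psi(\gamma')$. For $\mu,w:T^3\to[0,\infty)$ let $[w,\mu]_{Box}$, $[w,\mu]_{C}$, $[w,\mu]_{HC}$, $[w,\mu]_{CE}$ be the smallest real constants $C\ge 0$ such that, respectively, \[ \sum_{\alpha\le\beta} w(\alpha)(\mathbf I^*\mu(\alpha))^2\le C\sum_{\alpha\le\beta}\mu(\alpha)\quad\text{for all }\beta\in T^3, \] \[ \sum_{\alpha\in\mathcal D} w(\alpha)(\mathbf I^*\mu(\alpha))^2\le C\sum_{\alpha\in\mathcal D}\mu(\alpha)\quad\text{for all down-sets }\mathcal D\subseteq T^3, \] \[ \sum_{\alpha\in T^3} w(\alpha)(\mathbf I^*(\mu\mathbf 1_E)(\alpha))^2\le C\sum_{\alpha\in E}\mu(\alpha)\quad\text{for all }E\subseteq T^3,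 \] \[ \sum_{\alpha\in T^3} w(\alpha)|\mathbf I^*(\psi\mu)(\alpha)|^2\le C\sum_{\omega\in T^3}|\psi(\omega)|^2\mu(\omega)\quad\text{for all }\psi:T^3\to\mathbb R . \] Theorem. There is an absolute constant $K>0$ such that for every $3$-tree $T^3=T_1\times T_2\times T_3$, every $\mu:T^3\to[0,\infty)$ and every $w:T^3\to[0,\infty)$ of tensor product form, that is, $w(\alpha_1,\alpha_2,\alpha_3)=w_1(\alpha_1)w_2(\alpha_2)w_3(\alpha_3)$ with $w_i:T_i\to[0,\infty)$, one has \[ [w,\mu]_{Box}\le[w,\mu]_{C}\le[w,\mu]_{HC}\le[w,\mu]_{CE} \] and conversely \[ [w,\mu]_{CE}\le K[w,\mu]_{HC},\qquad [w,\mu]_{HC}\le K[w,\mu]_{C},\qquad [w,\mu]_{C}\le K[w,\mu]_{Box}. \] -/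

import Mathlib

namespace MultiTree

/-- A finite partially ordered set is a tree when the elements above any given element form a
chain. Several maximal elements are allowed. Finiteness is carried by a `Fintype` instance. -/
def IsTree (T : Type*) [PartialOrder T] : Prop :=
  ∀ ω : T, IsChain (· ≤ ·) {α : T | ω ≤ α}

/-- A weight on a product of three sets is of tensor product form. -/
def IsTensorProduct {T₁ T₂ T₃ : Type*} (w : T₁ × T₂ × T₃ → ℝ) : Prop :=
  ∃ (w₁ : T₁ → ℝ) (w₂ : T₂ → ℝ) (w₃ : T₃ → ℝ),
    (∀ α, 0 ≤ w₁ α) ∧ (∀ α, 0 ≤ w₂ α) ∧ (∀ α, 0 ≤ w₃ α) ∧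
      ∀ α, w α = w₁ α.1 * w₂ α.2.1 * w₃ α.2.2

variable {P : Type*} [Fintype P] [PartialOrder P]

open Classical in
/-- The adjoint Hardy operator `ψ ↦ (γ ↦ ∑_{γ' ≤ γ} ψ γ')`. -/
noncomputable def adjHardy (ψ : P → ℝ) (γ : P) : ℝ :=
  ∑ γ' with γ' ≤ γ, ψ γ'

open Classical in
/-- `C` is admissible in the one-box condition. -/
def IsBoxBound (w μ : P → ℝ) (C : ℝ) : Prop :=
  0 ≤ C ∧ ∀ β : P, ∑ α with α ≤ β, w α * (adjHardy μ α) ^ 2 ≤ C * ∑ α with α ≤ β, μ α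

/-- `C` is admissible in the Carleson condition, tested on all down-sets. -/
def IsCarlesonBound (w μ : P → ℝ) (C : ℝ) : Prop :=
  0 ≤ C ∧ ∀ D : Finset P, IsLowerSet (D : Set P) →
    ∑ α ∈ D, w α * (adjHardy μ α) ^ 2 ≤ C * ∑ α ∈ D, μ α

/-- `C` is admissible in the hereditary Carleson condition, tested on all subsets. -/
def IsHereditaryBound (w μ : P → ℝ) (C : ℝ) : Prop :=
  0 ≤ C ∧ ∀ E : Finset P,
    ∑ α, w α * (adjHardy ((E : Set P).indicator μ) α) ^ 2 ≤ C * ∑ α ∈ E, μ α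

/-- `C` is admissible in the (adjoint) Carleson embedding. -/
def IsEmbeddingBound (w μ : P → ℝ) (C : ℝ) : Prop :=
  0 ≤ C ∧ ∀ ψ : P → ℝ,
    ∑ α, w α * |adjHardy (fun ω => ψ ω * μ ω) α| ^ 2 ≤ C * ∑ ω, |ψ ω| ^ 2 * μ ω

/-- The box constant. -/
noncomputable def boxConst (w μ : P → ℝ) : ℝ := sInf {C | IsBoxBound w μ C}

/-- The Carleson constant. -/
noncomputable def carlesonConst (w μ : P → ℝ) : ℝ := sInf {C | IsCarlesonBound w μ C}

/-- The hereditary Carleson constant. -/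
noncomputable def hereditaryConst (w μ : P → ℝ) : ℝ := sInf {C | IsHereditaryBound w μ C}

/-- The Carleson embedding constant. -/
noncomputable def embeddingConst (w μ : P → ℝ) : ℝ := sInf {C | IsEmbeddingBound w μ C}

/-! For nonnegative `w` and `μ` the four infima are attained, so that the four constants are
indeed the smallest admissible numbers. -/

theorem exists_isEmbeddingBound {w μ : P → ℝ} (hw : ∀ α, 0 ≤ w α) (hμ : ∀ α, 0 ≤ μ α) :
    ∃ C, IsEmbeddingBound w μ C := by
  classical
  refine ⟨(∑ α, w α) * ∑ ω, μ ω,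
    mul_nonneg (Finset.sum_nonneg fun α _ => hw α) (Finset.sum_nonneg fun α _ => hμ α),
    fun ψ => ?_⟩
  rw [mul_assoc, Finset.sum_mul]
  refine Finset.sum_le_sum fun α _ => mul_le_mul_of_nonneg_left ?_ (hw α)
  rw [sq_abs, adjHardy]
  refine (Finset.sum_sq_le_sum_mul_sum_of_sq_le_mul _ (f := μ)
    (g := fun ω => |ψ ω| ^ 2 * μ ω) (fun i _ => hμ i)
    (fun i _ => mul_nonneg (sq_nonneg _) (hμ i)) ?_).trans ?_
  · intro i _
    simp only [sq_abs]
    exact le_of_eq (by ring)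
  · refine mul_le_mul ?_ ?_ ?_ (Finset.sum_nonneg fun i _ => hμ i)
    · exact Finset.sum_le_sum_of_subset_of_nonneg (Finset.filter_subset _ _) fun i _ _ => hμ i
    · exact Finset.sum_le_sum_of_subset_of_nonneg (Finset.filter_subset _ _)
        fun i _ _ => mul_nonneg (sq_nonneg _) (hμ i)
    · exact Finset.sum_nonneg fun i _ => mul_nonneg (sq_nonneg _) (hμ i)

theorem IsEmbeddingBound.isHereditaryBound {w μ : P → ℝ} {C : ℝ} (h : IsEmbeddingBound w μ C) :
    IsHereditaryBound w μ C := by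
  classical
  refine ⟨h.1, fun E => ?_⟩
  have h2 := h.2 ((E : Set P).indicator 1)
  have e1 : (fun ω => (E : Set P).indicator (1 : P → ℝ) ω * μ ω) = (E : Set P).indicator μ := by
    funext ω
    by_cases hω : ω ∈ E <;> simp [hω]
  have e2 : ∑ ω, |(E : Set P).indicator (1 : P → ℝ) ω| ^ 2 * μ ω = ∑ ω ∈ E, μ ω := by
    rw [← Finset.sum_subset (Finset.subset_univ E)]
    · exact Finset.sum_congr rfl fun x hx => by simp [hx]
    · intro x _ hx
      simp [hx]
  rw [e1, e2] at h2
  simpa only [sq_abs] using h2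

theorem IsHereditaryBound.isCarlesonBound {w μ : P → ℝ} (hw : ∀ α, 0 ≤ w α) {C : ℝ}
    (h : IsHereditaryBound w μ C) : IsCarlesonBound w μ C := by
  classical
  refine ⟨h.1, fun D hD => le_trans ?_ (h.2 D)⟩
  have e : ∀ α ∈ D, adjHardy ((D : Set P).indicator μ) α = adjHardy μ α := by
    intro α hα
    refine Finset.sum_congr rfl fun x hx => Set.indicator_of_mem ?_ _
    exact hD (Finset.mem_filter.1 hx).2 hα
  calc ∑ α ∈ D, w α * (adjHardy μ α) ^ 2
      = ∑ α ∈ D, w α * (adjHardy ((D : Set P).indicator μ) α) ^ 2 :=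
        Finset.sum_congr rfl fun α hα => by rw [e α hα]
    _ ≤ _ := Finset.sum_le_sum_of_subset_of_nonneg (Finset.subset_univ _)
        fun i _ _ => mul_nonneg (hw i) (sq_nonneg _)

theorem IsCarlesonBound.isBoxBound {w μ : P → ℝ} {C : ℝ} (h : IsCarlesonBound w μ C) :
    IsBoxBound w μ C := by
  classical
  refine ⟨h.1, fun β => ?_⟩
  have hD : IsLowerSet ((Finset.univ.filter fun α => α ≤ β : Finset P) : Set P) := by
    intro a b hba ha
    simp only [Finset.coe_filter, Finset.mem_univ, true_and, Set.mem_ofPred_eq] at ha ⊢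
    exact hba.trans ha
  convert h.2 _ hD

theorem isLeast_boxConst {w μ : P → ℝ} (hw : ∀ α, 0 ≤ w α) (hμ : ∀ α, 0 ≤ μ α) :
    IsLeast {C | IsBoxBound w μ C} (boxConst w μ) := by
  have hb : BddBelow {C | IsBoxBound w μ C} := ⟨0, fun _ hC => hC.1⟩
  obtain ⟨C, hC⟩ := exists_isEmbeddingBound hw hμ
  refine ⟨IsClosed.csInf_mem ?_ ⟨C, (hC.isHereditaryBound.isCarlesonBound hw).isBoxBound⟩ hb,
    fun C hC => csInf_le hb hC⟩
  simp only [IsBoxBound, Set.ofPred_and, Set.ofPred_forall]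
  exact (isClosed_le (by fun_prop) (by fun_prop)).inter
    (isClosed_iInter fun _ => isClosed_le (by fun_prop) (by fun_prop))

theorem isLeast_carlesonConst {w μ : P → ℝ} (hw : ∀ α, 0 ≤ w α) (hμ : ∀ α, 0 ≤ μ α) :
    IsLeast {C | IsCarlesonBound w μ C} (carlesonConst w μ) := by
  have hb : BddBelow {C | IsCarlesonBound w μ C} := ⟨0, fun _ hC => hC.1⟩
  obtain ⟨C, hC⟩ := exists_isEmbeddingBound hw hμ
  refine ⟨IsClosed.csInf_mem ?_ ⟨C, hC.isHereditaryBound.isCarlesonBound hw⟩ hb,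
    fun C hC => csInf_le hb hC⟩
  simp only [IsCarlesonBound, Set.ofPred_and, Set.ofPred_forall]
  exact (isClosed_le (by fun_prop) (by fun_prop)).inter
    (isClosed_iInter fun _ => isClosed_iInter fun _ =>
      isClosed_le (by fun_prop) (by fun_prop))

theorem isLeast_hereditaryConst {w μ : P → ℝ} (hw : ∀ α, 0 ≤ w α) (hμ : ∀ α, 0 ≤ μ α) :
    IsLeast {C | IsHereditaryBound w μ C} (hereditaryConst w μ) := by
  have hb : BddBelow {C | IsHereditaryBound w μ C} := ⟨0, fun _ hC => hC.1⟩
  obtain ⟨C, hC⟩ := exists_isEmbeddingBound hw hμ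
  refine ⟨IsClosed.csInf_mem ?_ ⟨C, hC.isHereditaryBound⟩ hb, fun C hC => csInf_le hb hC⟩
  simp only [IsHereditaryBound, Set.ofPred_and, Set.ofPred_forall]
  exact (isClosed_le (by fun_prop) (by fun_prop)).inter
    (isClosed_iInter fun _ => isClosed_le (by fun_prop) (by fun_prop))

theorem isLeast_embeddingConst {w μ : P → ℝ} (hw : ∀ α, 0 ≤ w α) (hμ : ∀ α, 0 ≤ μ α) :
    IsLeast {C | IsEmbeddingBound w μ C} (embeddingConst w μ) := by
  have hb : BddBelow {C | IsEmbeddingBound w μ C} := ⟨0, fun _ hC => hC.1⟩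
  refine ⟨IsClosed.csInf_mem ?_ (exists_isEmbeddingBound hw hμ) hb, fun C hC => csInf_le hb hC⟩
  simp only [IsEmbeddingBound, Set.ofPred_and, Set.ofPred_forall]
  exact (isClosed_le (by fun_prop) (by fun_prop)).inter
    (isClosed_iInter fun _ => isClosed_le (by fun_prop) (by fun_prop))

end MultiTree

/-! Write I for the Hardy operator and I* for its adjoint. The chain Box ≤ C ≤ HC ≤ CE only enlarges
the class of tests. The work is in CE ≲ HC and HC ≲ Box, and C lies between Box and HC.

Let V = I(w I*ν) be the potential of ν, so that the energy ∑ w (I*ν)² is the integral of V against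
ν. Let U be the part of V contributed by points where V ≤ δ. On one tree `IsTree.hardy_le` gives U ≤
δ everywhere. On a product this is replaced by `HasSmallTails`: for l ≥ 4δ, the integral of U dν
over {U > l} is at most 72 √(δ/l) times the energy. Trees and the tensor form of w are used only for
this. There `hardy_sq_le` bounds U² by I of mixed products of complementary partial sums, and
`IsTree.sum_hardy_sq_mul_sq_le` estimates these line by line. Consequently
(`HasSmallTails.truncEnergy_le`), if the energy is at most the mass, little energy lives where V is
small.

HC ≲ Box (`one_le_boxFactor_mul`): normalise HC to 1 and let ν be μ restricted to an extremal set.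
Put W = V - U. At least half of the energy sits where W is bounded below, so ∑ w (I*ν)² W is at
least a constant times the mass. Moving I from W onto w (I*ν)² turns this sum into one controlled by
the box condition.

CE ≲ HC (`le_of_eigenfunction`): an extremal ψ for the embedding satisfies I(w I*(ψμ)) = cψ on the
support of μ. On a low level set of ψ, the potential generated by a high level set is therefore
small, so the levels are almost orthogonal. Summing geometric series gives c ≲ c^(1/6), hence an
absolute bound on c. -/

namespace MultiTree

/-! ### The Hardy operator and its duality with the adjoint -/

section Hardy

variable {P : Type*} [Fintype P] [PartialOrder P]

open Classical in
/-- The Hardy operator `g ↦ (x ↦ ∑_{a ≥ x} g a)`. -/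
noncomputable def hardy (g : P → ℝ) (x : P) : ℝ :=
  ∑ a with x ≤ a, g a

theorem hardy_nonneg {g : P → ℝ} (hg : ∀ a, 0 ≤ g a) (x : P) : 0 ≤ hardy g x :=
  Finset.sum_nonneg fun a _ => hg a

theorem adjHardy_nonneg {g : P → ℝ} (hg : ∀ a, 0 ≤ g a) (x : P) : 0 ≤ adjHardy g x :=
  Finset.sum_nonneg fun a _ => hg a

theorem hardy_mono {g g' : P → ℝ} {x : P} (h : ∀ a, x ≤ a → g a ≤ g' a) :
    hardy g x ≤ hardy g' x := by
  classical exact Finset.sum_le_sum fun a ha => h a (Finset.mem_filter.1 ha).2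

theorem hardy_congr {g g' : P → ℝ} {x : P} (h : ∀ a, x ≤ a → g a = g' a) :
    hardy g x = hardy g' x := by
  classical exact Finset.sum_congr rfl fun a ha => h a (Finset.mem_filter.1 ha).2

theorem adjHardy_mono {g g' : P → ℝ} {x : P} (h : ∀ a, a ≤ x → g a ≤ g' a) :
    adjHardy g x ≤ adjHardy g' x := by
  classical exact Finset.sum_le_sum fun a ha => h a (Finset.mem_filter.1 ha).2

theorem adjHardy_congr {g g' : P → ℝ} {x : P} (h : ∀ a, a ≤ x → g a = g' a) :
    adjHardy g x = adjHardy g' x := by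
  classical exact Finset.sum_congr rfl fun a ha => h a (Finset.mem_filter.1 ha).2

theorem hardy_anti {g : P → ℝ} (hg : ∀ a, 0 ≤ g a) {x y : P} (h : x ≤ y) :
    hardy g y ≤ hardy g x := by
  classical
  refine Finset.sum_le_sum_of_subset_of_nonneg (fun a ha => ?_) fun a _ _ => hg a
  simp only [Finset.mem_filter, Finset.mem_univ, true_and] at ha ⊢
  exact h.trans ha

theorem adjHardy_eq_zero {g : P → ℝ} {x : P} (h : ∀ a, a ≤ x → g a = 0) : adjHardy g x = 0 := by
  classical exact Finset.sum_eq_zero fun a ha => h a (Finset.mem_filter.1 ha).2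

theorem adjHardy_const_mul (c : ℝ) (g : P → ℝ) (x : P) :
    adjHardy (fun a => c * g a) x = c * adjHardy g x := by
  simp only [adjHardy, Finset.mul_sum]

theorem hardy_const_mul (c : ℝ) (g : P → ℝ) (x : P) :
    hardy (fun a => c * g a) x = c * hardy g x := by
  simp only [hardy, Finset.mul_sum]

theorem hardy_add (g g' : P → ℝ) (x : P) :
    hardy (fun a => g a + g' a) x = hardy g x + hardy g' x := by
  simp only [hardy, Finset.sum_add_distrib]

theorem sum_mul_hardy (p g : P → ℝ) : ∑ x, p x * hardy g x = ∑ a, g a * adjHardy p a := by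
  classical
  simp only [hardy, adjHardy, Finset.mul_sum, Finset.sum_filter]
  rw [Finset.sum_comm]
  refine Finset.sum_congr rfl fun a _ => Finset.sum_congr rfl fun b _ => ?_
  split_ifs <;> ring

end Hardy

/-! ### One tree: maximum principle, product rule, superadditive functions -/

section Tree

theorem IsTree.le_total {T : Type*} [PartialOrder T] (hT : IsTree T) {x a b : T} (ha : x ≤ a) (hb : x ≤ b) :
    a ≤ b ∨ b ≤ a := by
  by_cases h : a = b
  · exact Or.inl h.le
  · exact hT x ha hb h

variable {T : Type*} [Fintype T] [PartialOrder T]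

/-- Maximum principle on a tree. -/
theorem IsTree.hardy_le (hT : IsTree T) {h : T → ℝ} (h0 : ∀ a, 0 ≤ h a) {c : ℝ} (hc : 0 ≤ c)
    (hs : ∀ x, h x ≠ 0 → hardy h x ≤ c) (x : T) : hardy h x ≤ c := by
  classical
  by_cases hne : (Finset.univ.filter fun a => x ≤ a ∧ h a ≠ 0).Nonempty
  -- The support of h above x is a chain, so its minimal element m lies below all of it and the sum
  -- at x is at most the sum at m.
  · obtain ⟨m, hm⟩ := Finset.exists_minimal hne
    have hm1 := (Finset.mem_filter.1 hm.prop).2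
    refine le_trans ?_ (hs m hm1.2)
    simp only [hardy, Finset.sum_filter]
    refine Finset.sum_le_sum fun a _ => ?_
    by_cases hxa : x ≤ a
    · by_cases ha : h a = 0
      · simp [ha]
      · have : m ≤ a := by
          rcases hT.le_total hm1.1 hxa with h1 | h1
          · exact h1
          · exact hm.le_of_le (Finset.mem_filter.2 ⟨Finset.mem_univ _, hxa, ha⟩) h1
        simp [hxa, this]
    · rw [if_neg hxa]
      split_ifs
      · exact h0 a
      · exact le_rfl
  · refine le_trans (le_of_eq (Finset.sum_eq_zero fun a ha => ?_)) hc
    by_contra hcon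
    exact hne ⟨a, Finset.mem_filter.2 ⟨Finset.mem_univ _, (Finset.mem_filter.1 ha).2, hcon⟩⟩

/-- A discrete product rule: any two points above x are comparable, so the double sum splits
according to which index is smaller. It is an inequality because the diagonal is counted twice. -/
theorem IsTree.hardy_mul_hardy_le (hT : IsTree T) {v g g' : T → ℝ} (hv : ∀ a, 0 ≤ v a)
    (hg : ∀ a, 0 ≤ g a) (hg' : ∀ a, 0 ≤ g' a) (x : T) :
    hardy (fun a => v a * g a) x * hardy (fun a => v a * g' a) x ≤
      hardy (fun a => v a * (g a * hardy (fun b => v b * g' b) a +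
        hardy (fun b => v b * g b) a * g' a)) x := by
  classical
  have key : ∀ a b, (if x ≤ a then v a * g a else 0) * (if x ≤ b then v b * g' b else 0) ≤
      (if x ≤ a then v a * g a * (if a ≤ b then v b * g' b else 0) else 0) +
      (if x ≤ b then v b * g' b * (if b ≤ a then v a * g a else 0) else 0) := by
    intro a b
    have h1 : 0 ≤ v a * g a := mul_nonneg (hv a) (hg a)
    have h2 : 0 ≤ v b * g' b := mul_nonneg (hv b) (hg' b)
    have h3 := mul_nonneg h1 h2
    by_cases ha : x ≤ a <;> by_cases hb : x ≤ b
    · rcases hT.le_total ha hb with h | h <;> simp only [ha, hb, h, if_true] <;>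
        split_ifs <;> nlinarith
    · simp only [ha, hb, if_true, if_false, mul_zero, add_zero]
      split_ifs <;> simp [h3]
    · simp only [ha, hb, if_true, if_false, zero_mul, zero_add]
      split_ifs <;> nlinarith
    · simp [ha, hb]
  have e : hardy (fun a => v a * (g a * hardy (fun b => v b * g' b) a +
        hardy (fun b => v b * g b) a * g' a)) x =
      ∑ a, ∑ b, ((if x ≤ a then v a * g a * (if a ≤ b then v b * g' b else 0) else 0) +
      (if x ≤ b then v b * g' b * (if b ≤ a then v a * g a else 0) else 0)) := by
    simp only [Finset.sum_add_distrib]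
    rw [Finset.sum_comm (f := fun a b =>
      if x ≤ b then v b * g' b * (if b ≤ a then v a * g a else 0) else 0)]
    rw [← Finset.sum_add_distrib]
    simp only [hardy, Finset.sum_filter]
    refine Finset.sum_congr rfl fun a _ => ?_
    by_cases ha : x ≤ a
    · simp only [ha, if_true]
      rw [← Finset.mul_sum, ← Finset.mul_sum]
      ring
    · simp [ha]
  rw [e]
  simp only [hardy, Finset.sum_filter]
  rw [Finset.sum_mul_sum]
  exact Finset.sum_le_sum fun a _ => Finset.sum_le_sum fun b _ => key a b

/-- A function `g` is superadditive if `∑_{a ≤ z} h a * g a ≤ c * g z` whenever the sums of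
`h ≥ 0` along upward rays are at most `c`; for `h` the indicator of an antichain this is
superadditivity in the usual sense. -/
def Superadditive (g : T → ℝ) : Prop :=
  ∀ h : T → ℝ, (∀ a, 0 ≤ h a) → ∀ c, (∀ x, hardy h x ≤ c) →
    ∀ z, adjHardy (fun a => h a * g a) z ≤ c * g z

/-- By duality the left side integrates, against m, the ray sums of h cut off at z. Such a ray sum
is at most c, and it vanishes at points not below z. -/
theorem superadditive_adjHardy {m : T → ℝ} (hm : ∀ a, 0 ≤ m a) : Superadditive (adjHardy m) := by
  classical
  intro h h0 c hc z
  calc adjHardy (fun a => h a * adjHardy m a) z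
      = ∑ a, (if a ≤ z then h a else 0) * adjHardy m a := by
        simp only [adjHardy, Finset.sum_filter, ite_mul, zero_mul]
    _ = ∑ y, m y * hardy (fun a => if a ≤ z then h a else 0) y := (sum_mul_hardy _ _).symm
    _ ≤ ∑ y, if y ≤ z then c * m y else 0 := by
        refine Finset.sum_le_sum fun y _ => ?_
        split_ifs with hy
        · rw [mul_comm]
          refine mul_le_mul_of_nonneg_right ((hardy_mono fun a _ => ?_).trans (hc y)) (hm y)
          split_ifs
          · exact le_rfl
          · exact h0 a
        · refine le_of_eq (mul_eq_zero_of_right _ (Finset.sum_eq_zero fun a ha => if_neg ?_))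
          exact fun h' => hy ((Finset.mem_filter.1 ha).2.trans h')
    _ = c * adjHardy m z := by
        simp only [adjHardy, Finset.sum_filter, Finset.mul_sum, mul_ite, mul_zero]

theorem Superadditive.indicator {g : T → ℝ} (hs : Superadditive g) (hg : ∀ a, 0 ≤ g a)
    {A : Set T} (hA : IsUpperSet A) : Superadditive (A.indicator g) := by
  intro h h0 c hc z
  by_cases hz : z ∈ A
  · rw [Set.indicator_of_mem hz]
    refine (adjHardy_mono fun a _ => ?_).trans (hs h h0 c hc z)
    exact mul_le_mul_of_nonneg_left (Set.indicator_le_self' (fun _ _ => hg _) a) (h0 a)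
  · rw [Set.indicator_of_notMem hz, mul_zero, adjHardy_eq_zero]
    intro a ha
    rw [Set.indicator_of_notMem fun h' => hz (hA ha h'), mul_zero]

theorem Superadditive.sum {ι : Type*} {s : Finset ι} {g : ι → T → ℝ} {k : ι → ℝ}
    (hs : ∀ i ∈ s, Superadditive (g i)) (hk : ∀ i, 0 ≤ k i) :
    Superadditive fun x => ∑ i ∈ s, k i * g i x := by
  classical
  intro h h0 c hc z
  have e : adjHardy (fun a => h a * ∑ i ∈ s, k i * g i a) z =
      ∑ i ∈ s, k i * adjHardy (fun a => h a * g i a) z := by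
    simp only [adjHardy, Finset.mul_sum]
    rw [Finset.sum_comm]
    exact Finset.sum_congr rfl fun i _ => Finset.sum_congr rfl fun a _ => by ring
  rw [e, Finset.mul_sum]
  refine Finset.sum_le_sum fun i hi => ?_
  calc _ ≤ k i * (c * g i z) := mul_le_mul_of_nonneg_left (hs i hi h h0 c hc z) (hk i)
    _ = _ := by ring

theorem Superadditive.hardy {S : Type*} [Fintype S] [PartialOrder S] {g : S → T → ℝ} {k : S → ℝ}
    (hs : ∀ i, Superadditive (g i)) (hk : ∀ i, 0 ≤ k i) (s : S) :
    Superadditive fun x => hardy (fun i => k i * g i x) s :=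
  Superadditive.sum (fun i _ => hs i) hk

/-- Expand the square of the sum of F by the product rule and dualise: superadditivity of Q on B
costs l. What is left is bilinear in F, and a second dualisation, with superadditivity of F, costs
δ. The factor 2 comes from the product rule. -/
theorem IsTree.sum_hardy_sq_mul_sq_le (hT : IsTree T) {v F Q : T → ℝ} (hv : ∀ a, 0 ≤ v a)
    (hF : ∀ a, 0 ≤ F a) (hQ : ∀ a, 0 ≤ Q a) (sF : Superadditive F) (sQ : Superadditive Q)
    {δ l : ℝ} (hδ : 0 ≤ δ) (hl : 0 ≤ l)
    (hA : ∀ t, F t ≠ 0 → MultiTree.hardy (fun a => v a * Q a) t ≤ δ) {B : Set T}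
    (hB : ∀ t ∈ B, MultiTree.hardy (fun a => v a * Q a) t ≤ l) :
    ∑ t, v t * (B.indicator (fun t => MultiTree.hardy (fun a => v a * F a) t * Q t) t) ^ 2 ≤
      2 * l * δ * ∑ t, v t * F t ^ 2 := by
  classical
  set JF := MultiTree.hardy (fun a => v a * F a) with hJF
  have hJ0 : ∀ t, 0 ≤ JF t := hardy_nonneg fun a => mul_nonneg (hv a) (hF a)
  have hQB : ∀ t, 0 ≤ B.indicator Q t := Set.indicator_nonneg fun t _ => hQ t
  -- The ray sums of vQ are at most l only on B; the maximum principle extends this to the whole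
  -- tree after cutting Q to B.
  have s1 : ∀ z, adjHardy (fun t => v t * B.indicator Q t * Q t) z ≤ l * Q z := by
    refine sQ (fun t => v t * B.indicator Q t) (fun t => mul_nonneg (hv t) (hQB t)) l ?_
    refine hT.hardy_le (fun t => mul_nonneg (hv t) (hQB t)) hl fun x hx => ?_
    have hxB : x ∈ B := by
      by_contra h
      simp [h] at hx
    refine (hardy_mono fun a _ => ?_).trans (hB x hxB)
    exact mul_le_mul_of_nonneg_left (Set.indicator_le_self' (fun _ _ => hQ _) a) (hv a)
  -- The same device with Q cut to the support of F, where its ray sums are at most δ.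
  have s2 : ∀ z, adjHardy (fun t => v t * F t * Q t) z ≤ δ * F z := by
    intro z
    have h0 : ∀ t, 0 ≤ v t * (if F t = 0 then 0 else Q t) := fun t =>
      mul_nonneg (hv t) (by split_ifs; exacts [le_rfl, hQ t])
    have := sF (fun t => v t * (if F t = 0 then 0 else Q t)) h0 δ ?_ z
    · refine le_trans (le_of_eq ?_) this
      refine adjHardy_congr fun a _ => ?_
      by_cases ha : F a = 0
      · simp [ha]
      · simp only [ha, if_false]
        ring
    · refine hT.hardy_le h0 hδ fun x hx => ?_
      have hx' : F x ≠ 0 := by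
        intro h
        simp [h] at hx
      refine (hardy_mono fun a _ => mul_le_mul_of_nonneg_left ?_ (hv a)).trans (hA x hx')
      split_ifs
      exacts [hQ a, le_rfl]
  calc ∑ t, v t * (B.indicator (fun t => JF t * Q t) t) ^ 2
      = ∑ t, (v t * B.indicator Q t * Q t) * JF t ^ 2 := by
        refine Finset.sum_congr rfl fun t _ => ?_
        by_cases ht : t ∈ B
        · simp only [ht, Set.indicator_of_mem]
          ring
        · simp [ht]
    _ ≤ ∑ t, (v t * B.indicator Q t * Q t) *
          MultiTree.hardy (fun a => v a * (F a * JF a + JF a * F a)) t := by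
        refine Finset.sum_le_sum fun t _ => mul_le_mul_of_nonneg_left ?_
          (mul_nonneg (mul_nonneg (hv t) (hQB t)) (hQ t))
        rw [sq]
        exact hT.hardy_mul_hardy_le hv hF hF t
    _ = ∑ a, (v a * (F a * JF a + JF a * F a)) *
          adjHardy (fun t => v t * B.indicator Q t * Q t) a := sum_mul_hardy _ _
    _ ≤ ∑ a, (v a * (F a * JF a + JF a * F a)) * (l * Q a) :=
        Finset.sum_le_sum fun a _ => mul_le_mul_of_nonneg_left (s1 a)
          (mul_nonneg (hv a) (add_nonneg (mul_nonneg (hF a) (hJ0 a))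
            (mul_nonneg (hJ0 a) (hF a))))
    _ = 2 * l * ∑ a, (v a * F a * Q a) * JF a := by
        rw [Finset.mul_sum]
        exact Finset.sum_congr rfl fun a _ => by ring
    _ = 2 * l * ∑ a, (v a * F a) * adjHardy (fun t => v t * F t * Q t) a := by
        rw [hJF, sum_mul_hardy]
    _ ≤ 2 * l * ∑ a, (v a * F a) * (δ * F a) :=
        mul_le_mul_of_nonneg_left (Finset.sum_le_sum fun a _ =>
          mul_le_mul_of_nonneg_left (s2 a) (mul_nonneg (hv a) (hF a))) (by positivity)
    _ = 2 * l * δ * ∑ t, v t * F t ^ 2 := by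
        rw [mul_assoc, mul_assoc, mul_assoc, Finset.mul_sum (a := δ)]
        congr 2
        exact Finset.sum_congr rfl fun a _ => by ring

end Tree

/-! ### Potentials, truncated potentials and energy -/

section Potential

variable {P : Type*} [Fintype P] [PartialOrder P]

/-- The potential of `ν`. -/
noncomputable def potential (w ν : P → ℝ) : P → ℝ :=
  hardy fun α => w α * adjHardy ν α

/-- The truncated potential of `ν`: only the points where the potential is at most `δ`
contribute. -/
noncomputable def truncPotential (w ν : P → ℝ) (δ : ℝ) : P → ℝ :=
  hardy fun α => w α * {x | potential w ν x ≤ δ}.indicator (adjHardy ν) α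

/-- The energy of `ν`. -/
noncomputable def energy (w ν : P → ℝ) : ℝ :=
  ∑ α, w α * adjHardy ν α ^ 2

theorem energy_nonneg {w : P → ℝ} (hw : ∀ α, 0 ≤ w α) (ν : P → ℝ) : 0 ≤ energy w ν :=
  Finset.sum_nonneg fun α _ => mul_nonneg (hw α) (sq_nonneg _)

theorem energy_mono {w ν ρ : P → ℝ} (hw : ∀ α, 0 ≤ w α) (hν : ∀ α, 0 ≤ ν α)
    (h : ∀ α, ν α ≤ ρ α) : energy w ν ≤ energy w ρ :=
  Finset.sum_le_sum fun α _ => mul_le_mul_of_nonneg_left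
    (pow_le_pow_left₀ (adjHardy_nonneg hν α) (adjHardy_mono fun a _ => h a) 2) (hw α)

theorem isUpperSet_hardy_le {g : P → ℝ} (hg : ∀ a, 0 ≤ g a) (c : ℝ) :
    IsUpperSet {x | hardy g x ≤ c} :=
  fun _ _ hab ha => (hardy_anti hg hab).trans ha

theorem truncPotential_nonneg {w ν : P → ℝ} (hw : ∀ α, 0 ≤ w α) (hν : ∀ α, 0 ≤ ν α) (δ : ℝ)
    (x : P) : 0 ≤ truncPotential w ν δ x :=
  hardy_nonneg (fun α => mul_nonneg (hw α)
    (Set.indicator_nonneg (fun a _ => adjHardy_nonneg hν a) α)) x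

theorem truncPotential_le {w ν : P → ℝ} (hw : ∀ α, 0 ≤ w α) (hν : ∀ α, 0 ≤ ν α) (δ : ℝ)
    (x : P) : truncPotential w ν δ x ≤ potential w ν x :=
  hardy_mono fun a _ => mul_le_mul_of_nonneg_left
    (Set.indicator_le_self' (fun _ _ => adjHardy_nonneg hν _) a) (hw a)

end Potential

/-! ### Iterated sums on products -/

section Prod

variable {S T : Type*} [Fintype S] [Fintype T] [PartialOrder S] [PartialOrder T]

theorem hardy_prod (g : S × T → ℝ) (x : S × T) :
    hardy g x = hardy (fun s => hardy (fun t => g (s, t)) x.2) x.1 := by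
  classical
  simp only [hardy, Finset.sum_filter, Fintype.sum_prod_type]
  refine Finset.sum_congr rfl fun s _ => ?_
  by_cases hs : x.1 ≤ s
  · simp [Prod.le_def, hs]
  · simp [Prod.le_def, hs]

theorem adjHardy_prod (g : S × T → ℝ) (x : S × T) :
    adjHardy g x = adjHardy (fun s => adjHardy (fun t => g (s, t)) x.2) x.1 := by
  classical
  simp only [adjHardy, Finset.sum_filter, Fintype.sum_prod_type]
  refine Finset.sum_congr rfl fun s _ => ?_
  by_cases hs : s ≤ x.1
  · simp [Prod.le_def, hs]
  · simp [Prod.le_def, hs]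

theorem hardy_mul_comm (u : S → ℝ) (v : T → ℝ) (g : S → T → ℝ) (s : S) (t : T) :
    hardy (fun a => u a * hardy (fun b => v b * g a b) t) s =
      hardy (fun b => v b * hardy (fun a => u a * g a b) s) t := by
  simp only [hardy, Finset.mul_sum]
  rw [Finset.sum_comm]
  exact Finset.sum_congr rfl fun i _ => Finset.sum_congr rfl fun a _ => by ring

theorem adjHardy_comm (g : S → T → ℝ) (s : S) (t : T) :
    adjHardy (fun a => adjHardy (fun b => g a b) t) s =
      adjHardy (fun b => adjHardy (fun a => g a b) s) t := by
  simp only [adjHardy]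
  rw [Finset.sum_comm]

end Prod

/-! ### Partial Hardy operators on three trees and the mixed terms -/

section Triple

set_option linter.unusedSectionVars false

variable {T₁ T₂ T₃ : Type*} [Fintype T₁] [Fintype T₂] [Fintype T₃]
  [PartialOrder T₁] [PartialOrder T₂] [PartialOrder T₃]

/-- Weighted Hardy operator in the first variable. -/
noncomputable def hardy₁ (w : T₁ → ℝ) (g : T₁ × T₂ × T₃ → ℝ) (x : T₁ × T₂ × T₃) : ℝ :=
  hardy (fun a => w a * g (a, x.2.1, x.2.2)) x.1

/-- Weighted Hardy operator in the second variable. -/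
noncomputable def hardy₂ (w : T₂ → ℝ) (g : T₁ × T₂ × T₃ → ℝ) (x : T₁ × T₂ × T₃) : ℝ :=
  hardy (fun b => w b * g (x.1, b, x.2.2)) x.2.1

/-- Weighted Hardy operator in the third variable. -/
noncomputable def hardy₃ (w : T₃ → ℝ) (g : T₁ × T₂ × T₃ → ℝ) (x : T₁ × T₂ × T₃) : ℝ :=
  hardy (fun c => w c * g (x.1, x.2.1, c)) x.2.2

variable {w₁ : T₁ → ℝ} {w₂ : T₂ → ℝ} {w₃ : T₃ → ℝ}

theorem hardy₁_hardy₂ (g : T₁ × T₂ × T₃ → ℝ) :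
    hardy₁ w₁ (hardy₂ w₂ g) = hardy₂ w₂ (hardy₁ w₁ g) :=
  funext fun x => hardy_mul_comm w₁ w₂ (fun a b => g (a, b, x.2.2)) x.1 x.2.1

theorem hardy₁_hardy₃ (g : T₁ × T₂ × T₃ → ℝ) :
    hardy₁ w₁ (hardy₃ w₃ g) = hardy₃ w₃ (hardy₁ w₁ g) :=
  funext fun x => hardy_mul_comm w₁ w₃ (fun a c => g (a, x.2.1, c)) x.1 x.2.2

theorem hardy₂_hardy₃ (g : T₁ × T₂ × T₃ → ℝ) :
    hardy₂ w₂ (hardy₃ w₃ g) = hardy₃ w₃ (hardy₂ w₂ g) :=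
  funext fun x => hardy_mul_comm w₂ w₃ (fun b c => g (x.1, b, c)) x.2.1 x.2.2

theorem hardy₁_nonneg (h₁ : ∀ a, 0 ≤ w₁ a) {g : T₁ × T₂ × T₃ → ℝ} (hg : ∀ x, 0 ≤ g x)
    (x : T₁ × T₂ × T₃) : 0 ≤ hardy₁ w₁ g x :=
  hardy_nonneg (fun a => mul_nonneg (h₁ a) (hg _)) _

theorem hardy₂_nonneg (h₂ : ∀ a, 0 ≤ w₂ a) {g : T₁ × T₂ × T₃ → ℝ} (hg : ∀ x, 0 ≤ g x)
    (x : T₁ × T₂ × T₃) : 0 ≤ hardy₂ w₂ g x :=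
  hardy_nonneg (fun a => mul_nonneg (h₂ a) (hg _)) _

theorem hardy₃_nonneg (h₃ : ∀ a, 0 ≤ w₃ a) {g : T₁ × T₂ × T₃ → ℝ} (hg : ∀ x, 0 ≤ g x)
    (x : T₁ × T₂ × T₃) : 0 ≤ hardy₃ w₃ g x :=
  hardy_nonneg (fun a => mul_nonneg (h₃ a) (hg _)) _

theorem hardy₁_mono (h₁ : ∀ a, 0 ≤ w₁ a) {g g' : T₁ × T₂ × T₃ → ℝ} (hg : ∀ x, g x ≤ g' x)
    (x : T₁ × T₂ × T₃) : hardy₁ w₁ g x ≤ hardy₁ w₁ g' x :=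
  hardy_mono fun a _ => mul_le_mul_of_nonneg_left (hg _) (h₁ a)

theorem hardy₂_mono (h₂ : ∀ a, 0 ≤ w₂ a) {g g' : T₁ × T₂ × T₃ → ℝ} (hg : ∀ x, g x ≤ g' x)
    (x : T₁ × T₂ × T₃) : hardy₂ w₂ g x ≤ hardy₂ w₂ g' x :=
  hardy_mono fun a _ => mul_le_mul_of_nonneg_left (hg _) (h₂ a)

theorem hardy₃_add (g g' : T₁ × T₂ × T₃ → ℝ) (x : T₁ × T₂ × T₃) :
    hardy₃ w₃ (fun x => g x + g' x) x = hardy₃ w₃ g x + hardy₃ w₃ g' x := by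
  simp only [hardy₃, mul_add, hardy_add]

theorem hardy_eq_hardy₁_hardy₂_hardy₃ (g : T₁ × T₂ × T₃ → ℝ) :
    hardy (fun α => w₁ α.1 * w₂ α.2.1 * w₃ α.2.2 * g α) =
      hardy₁ w₁ (hardy₂ w₂ (hardy₃ w₃ g)) := by
  funext x
  simp only [hardy_prod, hardy₁, hardy₂, hardy₃, ← hardy_const_mul, mul_assoc]

theorem hardy₁_mul_le (hT : IsTree T₁) (h₁ : ∀ a, 0 ≤ w₁ a) {g g' : T₁ × T₂ × T₃ → ℝ}
    (hg : ∀ x, 0 ≤ g x) (hg' : ∀ x, 0 ≤ g' x) (x : T₁ × T₂ × T₃) :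
    hardy₁ w₁ g x * hardy₁ w₁ g' x ≤
      hardy₁ w₁ (fun x => g x * hardy₁ w₁ g' x + hardy₁ w₁ g x * g' x) x :=
  hT.hardy_mul_hardy_le h₁ (fun _ => hg _) (fun _ => hg' _) x.1

theorem hardy₂_mul_le (hT : IsTree T₂) (h₂ : ∀ a, 0 ≤ w₂ a) {g g' : T₁ × T₂ × T₃ → ℝ}
    (hg : ∀ x, 0 ≤ g x) (hg' : ∀ x, 0 ≤ g' x) (x : T₁ × T₂ × T₃) :
    hardy₂ w₂ g x * hardy₂ w₂ g' x ≤
      hardy₂ w₂ (fun x => g x * hardy₂ w₂ g' x + hardy₂ w₂ g x * g' x) x :=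
  hT.hardy_mul_hardy_le h₂ (fun _ => hg _) (fun _ => hg' _) x.2.1

theorem hardy₃_mul_le (hT : IsTree T₃) (h₃ : ∀ a, 0 ≤ w₃ a) {g g' : T₁ × T₂ × T₃ → ℝ}
    (hg : ∀ x, 0 ≤ g x) (hg' : ∀ x, 0 ≤ g' x) (x : T₁ × T₂ × T₃) :
    hardy₃ w₃ g x * hardy₃ w₃ g' x ≤
      hardy₃ w₃ (fun x => g x * hardy₃ w₃ g' x + hardy₃ w₃ g x * g' x) x :=
  hT.hardy_mul_hardy_le h₃ (fun _ => hg _) (fun _ => hg' _) x.2.2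

/-- The square of the Hardy operator on a product of three trees is controlled by the products
of complementary partial Hardy operators. -/
theorem hardy_sq_le (hT₁ : IsTree T₁) (hT₂ : IsTree T₂) (hT₃ : IsTree T₃)
    (h₁ : ∀ a, 0 ≤ w₁ a) (h₂ : ∀ a, 0 ≤ w₂ a) (h₃ : ∀ a, 0 ≤ w₃ a)
    {F : T₁ × T₂ × T₃ → ℝ} (hF : ∀ x, 0 ≤ F x) (x : T₁ × T₂ × T₃) :
    hardy₁ w₁ (hardy₂ w₂ (hardy₃ w₃ F)) x ^ 2 ≤
      2 * hardy₁ w₁ (hardy₂ w₂ (hardy₃ w₃ fun x =>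
        F x * hardy₁ w₁ (hardy₂ w₂ (hardy₃ w₃ F)) x +
        hardy₁ w₁ F x * hardy₂ w₂ (hardy₃ w₃ F) x +
        hardy₂ w₂ F x * hardy₁ w₁ (hardy₃ w₃ F) x +
        hardy₃ w₃ F x * hardy₁ w₁ (hardy₂ w₂ F) x)) x := by
  have n₁ := hardy₁_nonneg h₁ hF
  have n₂ := hardy₂_nonneg h₂ hF
  have n₃ := hardy₃_nonneg h₃ hF
  have n₁₂ := hardy₁_nonneg h₁ n₂
  have n₁₃ := hardy₁_nonneg h₁ n₃
  have n₂₃ := hardy₂_nonneg h₂ n₃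
  have e₁₃ := hardy₁_hardy₃ (w₁ := w₁) (w₃ := w₃) F
  have e₂₃ := hardy₂_hardy₃ (w₂ := w₂) (w₃ := w₃) F
  -- Each product rule below needs both factors to be sums in the same variable; commuting the
  -- partial operators brings that variable outermost.
  have eU : hardy₁ w₁ (hardy₂ w₂ (hardy₃ w₃ F)) = hardy₂ w₂ (hardy₁ w₁ (hardy₃ w₃ F)) :=
    hardy₁_hardy₂ _
  have eU' : hardy₁ w₁ (hardy₂ w₂ (hardy₃ w₃ F)) = hardy₃ w₃ (hardy₁ w₁ (hardy₂ w₂ F)) := by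
    rw [e₂₃, hardy₁_hardy₃]
  set U := hardy₁ w₁ (hardy₂ w₂ (hardy₃ w₃ F)) with hU
  set f₁ := hardy₁ w₁ F
  set f₂ := hardy₂ w₂ F
  set f₃ := hardy₃ w₃ F with hf₃
  set f₁₂ := hardy₁ w₁ f₂
  set f₁₃ := hardy₁ w₁ f₃
  set f₂₃ := hardy₂ w₂ f₃ with hf₂₃
  have a1 : ∀ x, U x * U x ≤ hardy₁ w₁ (fun x => f₂₃ x * U x + U x * f₂₃ x) x :=
    hardy₁_mul_le hT₁ h₁ n₂₃ n₂₃
  have a2 : ∀ x, f₂₃ x * U x ≤ hardy₂ w₂ (fun x => f₃ x * U x + f₂₃ x * f₁₃ x) x := by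
    rw [eU]
    exact hardy₂_mul_le hT₂ h₂ n₃ n₁₃
  -- Of the two products left by the second variable, this one and the next are expanded in the
  -- third variable; together they give the four mixed terms.
  have a3 : ∀ x, f₃ x * U x ≤ hardy₃ w₃ (fun x => F x * U x + f₃ x * f₁₂ x) x := by
    rw [eU']
    exact hardy₃_mul_le hT₃ h₃ hF n₁₂
  have a4 : ∀ x, f₂₃ x * f₁₃ x ≤ hardy₃ w₃ (fun x => f₂ x * f₁₃ x + f₂₃ x * f₁ x) x := by
    rw [e₂₃, e₁₃]
    exact hardy₃_mul_le hT₃ h₃ n₂ n₁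
  have a5 : ∀ x, f₃ x * U x + f₂₃ x * f₁₃ x ≤ hardy₃ w₃ (fun x =>
      F x * U x + f₁ x * f₂₃ x + f₂ x * f₁₃ x + f₃ x * f₁₂ x) x := by
    intro x
    refine (add_le_add (a3 x) (a4 x)).trans (le_of_eq ?_)
    rw [← hardy₃_add]
    congr 1
    funext y
    ring
  have a6 : ∀ x, f₂₃ x * U x + U x * f₂₃ x ≤ 2 * hardy₂ w₂ (hardy₃ w₃ (fun x =>
      F x * U x + f₁ x * f₂₃ x + f₂ x * f₁₃ x + f₃ x * f₁₂ x)) x := by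
    intro x
    have := (a2 x).trans (hardy₂_mono h₂ a5 x)
    linarith
  rw [sq]
  refine (a1 x).trans ((hardy₁_mono h₁ a6 x).trans (le_of_eq ?_))
  simp only [hardy₁, ← hardy_const_mul]
  exact hardy_congr fun a _ => by ring

theorem superadditive_adjHardy₁ {ν : T₁ × T₂ × T₃ → ℝ} (hν : ∀ x, 0 ≤ ν x) (b : T₂) (c : T₃) :
    Superadditive fun a => adjHardy ν (a, b, c) := by
  simp only [adjHardy_prod]
  exact superadditive_adjHardy fun a => adjHardy_nonneg (fun b => adjHardy_nonneg
    (fun c => hν _) _) _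

theorem superadditive_adjHardy₂ {ν : T₁ × T₂ × T₃ → ℝ} (hν : ∀ x, 0 ≤ ν x) (a : T₁) (c : T₃) :
    Superadditive fun b => adjHardy ν (a, b, c) := by
  simp only [adjHardy_prod]
  simp only [adjHardy_comm _ a]
  exact superadditive_adjHardy fun a => adjHardy_nonneg (fun b => adjHardy_nonneg
    (fun c => hν _) _) _

theorem superadditive_adjHardy₃ {ν : T₁ × T₂ × T₃ → ℝ} (hν : ∀ x, 0 ≤ ν x) (a : T₁) (b : T₂) :
    Superadditive fun c => adjHardy ν (a, b, c) := by
  simp only [adjHardy_prod]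
  simp only [adjHardy_comm _ b]
  simp only [adjHardy_comm _ a]
  exact superadditive_adjHardy fun a => adjHardy_nonneg (fun b => adjHardy_nonneg
    (fun c => hν _) _) _

section Mixed

variable {F : T₁ × T₂ × T₃ → ℝ} {δ l : ℝ} {B : Set (T₁ × T₂ × T₃)}

/-- Apply the one-tree estimate on every line parallel to the first axis, with Q the sum of F in the
other two variables: the ray sums of Q are then the full potential of F. The tensor form of the
weight lets its other two factors come out of each line. -/
theorem sum_hardy₁_mul_sq_le (hT₁ : IsTree T₁)
    (h₁ : ∀ a, 0 ≤ w₁ a) (h₂ : ∀ a, 0 ≤ w₂ a) (h₃ : ∀ a, 0 ≤ w₃ a) (hF : ∀ x, 0 ≤ F x)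
    (sF : ∀ b c, Superadditive fun a => F (a, b, c)) (hδ : 0 ≤ δ) (hl : 0 ≤ l)
    (hA : ∀ x, F x ≠ 0 → hardy₁ w₁ (hardy₂ w₂ (hardy₃ w₃ F)) x ≤ δ)
    (hB : ∀ x ∈ B, hardy₁ w₁ (hardy₂ w₂ (hardy₃ w₃ F)) x ≤ l) :
    ∑ x, w₁ x.1 * w₂ x.2.1 * w₃ x.2.2 *
        B.indicator (fun x => hardy₁ w₁ F x * hardy₂ w₂ (hardy₃ w₃ F) x) x ^ 2 ≤
      2 * l * δ * ∑ x, w₁ x.1 * w₂ x.2.1 * w₃ x.2.2 * F x ^ 2 := by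
  have key : ∀ b c, ∑ a, w₁ a * w₂ b * w₃ c *
        B.indicator (fun x => hardy₁ w₁ F x * hardy₂ w₂ (hardy₃ w₃ F) x) (a, b, c) ^ 2 ≤
      2 * l * δ * ∑ a, w₁ a * w₂ b * w₃ c * F (a, b, c) ^ 2 := by
    intro b c
    have := hT₁.sum_hardy_sq_mul_sq_le (v := w₁) (F := fun a => F (a, b, c))
      (Q := fun a => hardy₂ w₂ (hardy₃ w₃ F) (a, b, c)) (B := {a | (a, b, c) ∈ B}) h₁
      (fun a => hF _) (fun a => hardy₂_nonneg h₂ (hardy₃_nonneg h₃ hF) _) (sF b c)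
      (Superadditive.hardy (fun b' => Superadditive.hardy (fun c' => sF b' c') h₃ c) h₂ b)
      hδ hl (fun a ha => hA (a, b, c) ha) (fun a ha => hB (a, b, c) ha)
    have := mul_le_mul_of_nonneg_left this (mul_nonneg (h₂ b) (h₃ c))
    rw [mul_left_comm, Finset.mul_sum, Finset.mul_sum] at this
    refine le_of_eq_of_le (Finset.sum_congr rfl fun a _ => ?_)
      (this.trans (le_of_eq (congrArg _ (Finset.sum_congr rfl fun a _ => ?_))))
    · have e : B.indicator (fun x => hardy₁ w₁ F x * hardy₂ w₂ (hardy₃ w₃ F) x) (a, b, c) =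
        {a | (a, b, c) ∈ B}.indicator (fun a => hardy (fun a => w₁ a * F (a, b, c)) a *
          hardy₂ w₂ (hardy₃ w₃ F) (a, b, c)) a := rfl
      rw [e]
      ring
    · ring
  simp only [Fintype.sum_prod_type]
  rw [Finset.sum_comm, Finset.sum_comm (γ := T₁), Finset.mul_sum]
  refine Finset.sum_le_sum fun b _ => ?_
  rw [Finset.sum_comm, Finset.sum_comm (γ := T₁), Finset.mul_sum]
  exact Finset.sum_le_sum fun c _ => key b c

theorem sum_hardy₂_mul_sq_le (hT₂ : IsTree T₂)
    (h₁ : ∀ a, 0 ≤ w₁ a) (h₂ : ∀ a, 0 ≤ w₂ a) (h₃ : ∀ a, 0 ≤ w₃ a) (hF : ∀ x, 0 ≤ F x)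
    (sF : ∀ a c, Superadditive fun b => F (a, b, c)) (hδ : 0 ≤ δ) (hl : 0 ≤ l)
    (hA : ∀ x, F x ≠ 0 → hardy₁ w₁ (hardy₂ w₂ (hardy₃ w₃ F)) x ≤ δ)
    (hB : ∀ x ∈ B, hardy₁ w₁ (hardy₂ w₂ (hardy₃ w₃ F)) x ≤ l) :
    ∑ x, w₁ x.1 * w₂ x.2.1 * w₃ x.2.2 *
        B.indicator (fun x => hardy₂ w₂ F x * hardy₁ w₁ (hardy₃ w₃ F) x) x ^ 2 ≤
      2 * l * δ * ∑ x, w₁ x.1 * w₂ x.2.1 * w₃ x.2.2 * F x ^ 2 := by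
  rw [hardy₁_hardy₂] at hA hB
  have key : ∀ a c, ∑ b, w₁ a * w₂ b * w₃ c *
        B.indicator (fun x => hardy₂ w₂ F x * hardy₁ w₁ (hardy₃ w₃ F) x) (a, b, c) ^ 2 ≤
      2 * l * δ * ∑ b, w₁ a * w₂ b * w₃ c * F (a, b, c) ^ 2 := by
    intro a c
    have := hT₂.sum_hardy_sq_mul_sq_le (v := w₂) (F := fun b => F (a, b, c))
      (Q := fun b => hardy₁ w₁ (hardy₃ w₃ F) (a, b, c)) (B := {b | (a, b, c) ∈ B}) h₂
      (fun b => hF _) (fun b => hardy₁_nonneg h₁ (hardy₃_nonneg h₃ hF) _) (sF a c)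
      (Superadditive.hardy (fun a' => Superadditive.hardy (fun c' => sF a' c') h₃ c) h₁ a)
      hδ hl (fun b hb => hA (a, b, c) hb) (fun b hb => hB (a, b, c) hb)
    have := mul_le_mul_of_nonneg_left this (mul_nonneg (h₁ a) (h₃ c))
    rw [mul_left_comm, Finset.mul_sum, Finset.mul_sum] at this
    refine le_of_eq_of_le (Finset.sum_congr rfl fun b _ => ?_)
      (this.trans (le_of_eq (congrArg _ (Finset.sum_congr rfl fun b _ => ?_))))
    · have e : B.indicator (fun x => hardy₂ w₂ F x * hardy₁ w₁ (hardy₃ w₃ F) x) (a, b, c) =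
        {b | (a, b, c) ∈ B}.indicator (fun b => hardy (fun b => w₂ b * F (a, b, c)) b *
          hardy₁ w₁ (hardy₃ w₃ F) (a, b, c)) b := rfl
      rw [e]
      ring
    · ring
  simp only [Fintype.sum_prod_type]
  rw [Finset.mul_sum]
  refine Finset.sum_le_sum fun a _ => ?_
  rw [Finset.sum_comm, Finset.sum_comm (γ := T₂), Finset.mul_sum]
  exact Finset.sum_le_sum fun c _ => key a c

theorem sum_hardy₃_mul_sq_le (hT₃ : IsTree T₃)
    (h₁ : ∀ a, 0 ≤ w₁ a) (h₂ : ∀ a, 0 ≤ w₂ a) (h₃ : ∀ a, 0 ≤ w₃ a) (hF : ∀ x, 0 ≤ F x)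
    (sF : ∀ a b, Superadditive fun c => F (a, b, c)) (hδ : 0 ≤ δ) (hl : 0 ≤ l)
    (hA : ∀ x, F x ≠ 0 → hardy₁ w₁ (hardy₂ w₂ (hardy₃ w₃ F)) x ≤ δ)
    (hB : ∀ x ∈ B, hardy₁ w₁ (hardy₂ w₂ (hardy₃ w₃ F)) x ≤ l) :
    ∑ x, w₁ x.1 * w₂ x.2.1 * w₃ x.2.2 *
        B.indicator (fun x => hardy₃ w₃ F x * hardy₁ w₁ (hardy₂ w₂ F) x) x ^ 2 ≤
      2 * l * δ * ∑ x, w₁ x.1 * w₂ x.2.1 * w₃ x.2.2 * F x ^ 2 := by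
  rw [hardy₂_hardy₃, hardy₁_hardy₃] at hA hB
  have key : ∀ a b, ∑ c, w₁ a * w₂ b * w₃ c *
        B.indicator (fun x => hardy₃ w₃ F x * hardy₁ w₁ (hardy₂ w₂ F) x) (a, b, c) ^ 2 ≤
      2 * l * δ * ∑ c, w₁ a * w₂ b * w₃ c * F (a, b, c) ^ 2 := by
    intro a b
    have := hT₃.sum_hardy_sq_mul_sq_le (v := w₃) (F := fun c => F (a, b, c))
      (Q := fun c => hardy₁ w₁ (hardy₂ w₂ F) (a, b, c)) (B := {c | (a, b, c) ∈ B}) h₃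
      (fun c => hF _) (fun c => hardy₁_nonneg h₁ (hardy₂_nonneg h₂ hF) _) (sF a b)
      (Superadditive.hardy (fun a' => Superadditive.hardy (fun b' => sF a' b') h₂ b) h₁ a)
      hδ hl (fun c hc => hA (a, b, c) hc) (fun c hc => hB (a, b, c) hc)
    have := mul_le_mul_of_nonneg_left this (mul_nonneg (h₁ a) (h₂ b))
    rw [mul_left_comm, Finset.mul_sum, Finset.mul_sum] at this
    refine le_of_eq_of_le (Finset.sum_congr rfl fun c _ => ?_)
      (this.trans (le_of_eq (congrArg _ (Finset.sum_congr rfl fun c _ => ?_))))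
    · have e : B.indicator (fun x => hardy₃ w₃ F x * hardy₁ w₁ (hardy₂ w₂ F) x) (a, b, c) =
        {c | (a, b, c) ∈ B}.indicator (fun c => hardy (fun c => w₃ c * F (a, b, c)) c *
          hardy₁ w₁ (hardy₂ w₂ F) (a, b, c)) c := rfl
      rw [e]
      ring
    · ring
  simp only [Fintype.sum_prod_type]
  rw [Finset.mul_sum]
  refine Finset.sum_le_sum fun a _ => ?_
  rw [Finset.mul_sum]
  exact Finset.sum_le_sum fun b _ => key a b

end Mixed

end Triple

/-! ### Weighted Cauchy–Schwarz -/

section CauchySchwarz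

variable {P : Type*} [Fintype P]

theorem sum_mul_mul_sq_le {w : P → ℝ} (hw : ∀ α, 0 ≤ w α) (g h : P → ℝ) :
    (∑ α, w α * g α * h α) ^ 2 ≤ (∑ α, w α * g α ^ 2) * ∑ α, w α * h α ^ 2 :=
  Finset.sum_sq_le_sum_mul_sum_of_sq_le_mul _ (fun i _ => mul_nonneg (hw i) (sq_nonneg _))
    (fun i _ => mul_nonneg (hw i) (sq_nonneg _)) fun i _ => le_of_eq (by ring)

end CauchySchwarz

/-! ### Small tails of truncated potentials -/

section Key

variable {P : Type*} [Fintype P] [PartialOrder P]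

/-- The part of a truncated potential `V_δ` above a level `l ≥ 4 δ` contributes little to the
energy. -/
def HasSmallTails (w : P → ℝ) : Prop :=
  ∀ ν : P → ℝ, (∀ α, 0 ≤ ν α) → ∀ δ l : ℝ, 0 < δ → 4 * δ ≤ l →
    ∑ γ, ν γ * {x | l < truncPotential w ν δ x}.indicator (truncPotential w ν δ) γ ≤
      72 * √(δ / l) * energy w ν

variable {T₁ T₂ T₃ : Type*} [Fintype T₁] [Fintype T₂] [Fintype T₃]
  [PartialOrder T₁] [PartialOrder T₂] [PartialOrder T₃]

/-- On the layer, l U ≤ U², and U² is bounded by I of four terms. Dualising, the three mixed ones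
are handled by Cauchy–Schwarz against the energy of ν restricted to the layer, and the term F U is
absorbed on the left. -/
theorem sum_truncPotential_level_le (hT₁ : IsTree T₁) (hT₂ : IsTree T₂) (hT₃ : IsTree T₃)
    {w : T₁ × T₂ × T₃ → ℝ} (hw : ∀ α, 0 ≤ w α) (ht : IsTensorProduct w)
    {ν : T₁ × T₂ × T₃ → ℝ} (hν : ∀ α, 0 ≤ ν α) {δ l : ℝ} (hδ : 0 < δ) (hl : 4 * δ ≤ l) :
    ∑ γ, ν γ * {x | l < truncPotential w ν δ x ∧ truncPotential w ν δ x ≤ 4 * l}.indicator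
      (truncPotential w ν δ) γ ≤ 36 * √(δ / l) * energy w ν := by
  classical
  obtain ⟨w₁, w₂, w₃, h₁, h₂, h₃, hwt⟩ := ht
  obtain rfl : w = fun α => w₁ α.1 * w₂ α.2.1 * w₃ α.2.2 := funext hwt
  set w : T₁ × T₂ × T₃ → ℝ := fun α => w₁ α.1 * w₂ α.2.1 * w₃ α.2.2 with hwdef
  have hl0 : 0 < l := by linarith
  set A : Set (T₁ × T₂ × T₃) := {x | potential w ν x ≤ δ} with hAdef
  have hA : IsUpperSet A :=
    isUpperSet_hardy_le (fun α => mul_nonneg (hw α) (adjHardy_nonneg hν α)) δ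
  set F := A.indicator (adjHardy ν) with hFdef
  have hf : ∀ x, 0 ≤ adjHardy ν x := adjHardy_nonneg hν
  have hF : ∀ x, 0 ≤ F x := Set.indicator_nonneg fun x _ => hf x
  have hU : truncPotential w ν δ = hardy₁ w₁ (hardy₂ w₂ (hardy₃ w₃ F)) :=
    hardy_eq_hardy₁_hardy₂_hardy₃ F
  have hU' : truncPotential w ν δ = hardy fun α => w α * F α := rfl
  set U := truncPotential w ν δ with hUdef
  have hU0 : ∀ x, 0 ≤ U x := truncPotential_nonneg hw hν δ
  have hUA : ∀ x, F x ≠ 0 → U x ≤ δ := by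
    intro x hx
    have hxA : x ∈ A := by
      by_contra h
      exact hx (Set.indicator_of_notMem h _)
    exact (truncPotential_le hw hν δ x).trans hxA
  -- An up-set containing the layer: cutting the integrand to B does not change I at points of the
  -- layer, and it supplies the upper bound on U that the mixed estimates need.
  set B : Set (T₁ × T₂ × T₃) := {x | U x ≤ 4 * l} with hBdef
  have hB : IsUpperSet B :=
    isUpperSet_hardy_le (fun α => mul_nonneg (hw α) (hF α)) (4 * l)
  have s₁ : ∀ b c, Superadditive fun a => F (a, b, c) := fun b c =>
    (superadditive_adjHardy₁ hν b c).indicator (fun a => hf _) (A := {a | (a, b, c) ∈ A})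
      fun a a' haa ha => hA (a := (a, b, c)) (b := (a', b, c)) ⟨haa, le_rfl, le_rfl⟩ ha
  have s₂ : ∀ a c, Superadditive fun b => F (a, b, c) := fun a c =>
    (superadditive_adjHardy₂ hν a c).indicator (fun b => hf _) (A := {b | (a, b, c) ∈ A})
      fun b b' hbb hb => hA (a := (a, b, c)) (b := (a, b', c)) ⟨le_rfl, hbb, le_rfl⟩ hb
  have s₃ : ∀ a b, Superadditive fun c => F (a, b, c) := fun a b =>
    (superadditive_adjHardy₃ hν a b).indicator (fun c => hf _) (A := {c | (a, b, c) ∈ A})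
      fun c c' hcc hc => hA (a := (a, b, c)) (b := (a, b, c')) ⟨le_rfl, le_rfl, hcc⟩ hc
  set E := energy w ν with hE
  have hE0 : 0 ≤ E := energy_nonneg hw ν
  have hFE : ∑ x, w x * F x ^ 2 ≤ E := Finset.sum_le_sum fun x _ =>
    mul_le_mul_of_nonneg_left (pow_le_pow_left₀ (hF x)
      (Set.indicator_le_self' (fun _ _ => hf _) x) 2) (hw x)
  set G : Set (T₁ × T₂ × T₃) := {x | l < U x ∧ U x ≤ 4 * l} with hGdef
  set ρ := G.indicator ν with hρ
  have hρ0 : ∀ x, 0 ≤ ρ x := Set.indicator_nonneg fun x _ => hν x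
  have hρE : energy w ρ ≤ E :=
    energy_mono hw hρ0 fun x => Set.indicator_le_self' (fun _ _ => hν _) x
  have q0 : 0 ≤ √(l * δ) := Real.sqrt_nonneg _
  have q2 : √(l * δ) ^ 2 = l * δ := Real.sq_sqrt (by positivity)
  -- Here 2 · (4l) · δ = 8lδ, and √8 is rounded up to 3.
  have bound : ∀ R : T₁ × T₂ × T₃ → ℝ,
      ∑ x, w x * B.indicator R x ^ 2 ≤ 2 * (4 * l) * δ * ∑ x, w x * F x ^ 2 →
      ∑ x, w x * B.indicator R x * adjHardy ρ x ≤ 3 * √(l * δ) * E := by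
    intro R hR
    have c1 := sum_mul_mul_sq_le hw (B.indicator R) (adjHardy ρ)
    have c2 : ∑ x, w x * B.indicator R x ^ 2 ≤ 8 * (l * δ) * E := by
      have := mul_le_mul_of_nonneg_left hFE (show 0 ≤ 2 * (4 * l) * δ by positivity)
      linarith
    have c3 : (∑ x, w x * B.indicator R x * adjHardy ρ x) ^ 2 ≤ 8 * (l * δ) * E * E :=
      c1.trans (mul_le_mul c2 hρE (energy_nonneg hw ρ) (by positivity))
    refine le_of_sq_le_sq (c3.trans ?_) (by positivity)
    rw [mul_pow, mul_pow, q2]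
    have : 0 ≤ l * δ * E ^ 2 := by positivity
    linarith
  have b₁ := bound _ (sum_hardy₁_mul_sq_le hT₁ h₁ h₂ h₃ hF s₁ hδ.le (by positivity)
    (hU ▸ hUA) (hU ▸ fun x (hx : x ∈ B) => hx))
  have b₂ := bound _ (sum_hardy₂_mul_sq_le hT₂ h₁ h₂ h₃ hF s₂ hδ.le (by positivity)
    (hU ▸ hUA) (hU ▸ fun x (hx : x ∈ B) => hx))
  have b₃ := bound _ (sum_hardy₃_mul_sq_le hT₃ h₁ h₂ h₃ hF s₃ hδ.le (by positivity)
    (hU ▸ hUA) (hU ▸ fun x (hx : x ∈ B) => hx))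
  have b₀ : ∑ x, w x * B.indicator (fun x => F x * U x) x * adjHardy ρ x ≤
      δ * ∑ x, ρ x * U x := by
    rw [hU', sum_mul_hardy, Finset.mul_sum]
    refine Finset.sum_le_sum fun x _ => ?_
    have k1 : B.indicator (fun x => F x * U x) x ≤ δ * F x := by
      refine (Set.indicator_le_self' (fun x _ => mul_nonneg (hF x) (hU0 x)) x).trans ?_
      by_cases hx : F x = 0
      · simp [hx]
      · rw [mul_comm]
        exact mul_le_mul_of_nonneg_right (hUA x hx) (hF x)
    calc _ ≤ w x * (δ * F x) * adjHardy ρ x :=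
          mul_le_mul_of_nonneg_right (mul_le_mul_of_nonneg_left k1 (hw x)) (adjHardy_nonneg hρ0 x)
      _ = _ := by ring
  have hsq : ∑ x, ρ x * U x ^ 2 ≤ 2 * (δ * ∑ x, ρ x * U x + 9 * √(l * δ) * E) := by
    calc ∑ x, ρ x * U x ^ 2
        ≤ ∑ x, ρ x * (2 * hardy (fun α => w α * (B.indicator (fun x => F x * U x) α +
            B.indicator (fun x => hardy₁ w₁ F x * hardy₂ w₂ (hardy₃ w₃ F) x) α +
            B.indicator (fun x => hardy₂ w₂ F x * hardy₁ w₁ (hardy₃ w₃ F) x) α +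
            B.indicator (fun x => hardy₃ w₃ F x * hardy₁ w₁ (hardy₂ w₂ F) x) α)) x) := by
          refine Finset.sum_le_sum fun x _ => ?_
          by_cases hx : x ∈ G
          · refine mul_le_mul_of_nonneg_left ?_ (hρ0 x)
            have := hardy_sq_le hT₁ hT₂ hT₃ h₁ h₂ h₃ hF x
            rw [← hU, ← hardy_eq_hardy₁_hardy₂_hardy₃] at this
            refine this.trans (le_of_eq (congrArg _ (hardy_congr fun α hα => ?_)))
            have hαB : α ∈ B := hB hα hx.2
            simp only [Set.indicator_of_mem hαB]
            rfl
          · simp [hρ, hx]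
      _ = 2 * (∑ x, w x * B.indicator (fun x => F x * U x) x * adjHardy ρ x +
            ∑ x, w x * B.indicator (fun x => hardy₁ w₁ F x * hardy₂ w₂ (hardy₃ w₃ F) x) x *
              adjHardy ρ x +
            ∑ x, w x * B.indicator (fun x => hardy₂ w₂ F x * hardy₁ w₁ (hardy₃ w₃ F) x) x *
              adjHardy ρ x +
            ∑ x, w x * B.indicator (fun x => hardy₃ w₃ F x * hardy₁ w₁ (hardy₂ w₂ F) x) x *
              adjHardy ρ x) := by
          simp only [mul_left_comm _ (2 : ℝ)]
          rw [← Finset.mul_sum, sum_mul_hardy, ← Finset.sum_add_distrib,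
            ← Finset.sum_add_distrib, ← Finset.sum_add_distrib]
          congr 1
          exact Finset.sum_congr rfl fun x _ => by ring
      _ ≤ _ := by linarith
  have hlow : l * ∑ x, ρ x * U x ≤ ∑ x, ρ x * U x ^ 2 := by
    rw [Finset.mul_sum]
    refine Finset.sum_le_sum fun x _ => ?_
    by_cases hx : x ∈ G
    · have := mul_le_mul_of_nonneg_left hx.1.le (mul_nonneg (hρ0 x) (hU0 x))
      calc _ = ρ x * U x * l := by ring
        _ ≤ _ := this
        _ = _ := by ring
    · simp [hρ, hx]
  have hsum : ∑ γ, ν γ * G.indicator U γ = ∑ x, ρ x * U x := by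
    refine Finset.sum_congr rfl fun x _ => ?_
    by_cases hx : x ∈ G <;> simp [hρ, hx]
  rw [hsum]
  have hS0 : 0 ≤ ∑ x, ρ x * U x := Finset.sum_nonneg fun x _ => mul_nonneg (hρ0 x) (hU0 x)
  have hq : √(l * δ) = l * √(δ / l) := by
    rw [show l * δ = l ^ 2 * (δ / l) by field_simp, Real.sqrt_mul (sq_nonneg l),
      Real.sqrt_sq hl0.le]
  rw [hq] at hsq
  -- The hypothesis 4δ ≤ l makes twice this term at most half of the left side, so it can be
  -- absorbed.
  have h4 : δ * ∑ x, ρ x * U x ≤ l / 4 * ∑ x, ρ x * U x :=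
    mul_le_mul_of_nonneg_right (by linarith) hS0
  refine le_of_mul_le_mul_left ?_ hl0
  linarith

/-- Sum the layers l, 4l, 16l, ...: each step halves √(δ/l), so the constant closes up as 36 + 72/2
= 72. The induction stops because U is bounded on a finite set. -/
theorem hasSmallTails_of_isTensorProduct (hT₁ : IsTree T₁) (hT₂ : IsTree T₂) (hT₃ : IsTree T₃)
    {w : T₁ × T₂ × T₃ → ℝ} (hw : ∀ α, 0 ≤ w α) (ht : IsTensorProduct w) : HasSmallTails w := by
  classical
  intro ν hν δ l hδ hl
  set U := truncPotential w ν δ with hU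
  have hE : 0 ≤ energy w ν := energy_nonneg hw ν
  have hU0 : ∀ x, 0 ≤ U x := truncPotential_nonneg hw hν δ
  have main : ∀ n : ℕ, ∀ l, 4 * δ ≤ l → (∀ x, U x ≤ 4 ^ n * l) →
      ∑ γ, ν γ * {x | l < U x}.indicator U γ ≤ 72 * √(δ / l) * energy w ν := by
    intro n
    induction n with
    | zero =>
      intro l hl hb
      refine le_trans (le_of_eq (Finset.sum_eq_zero fun x _ => ?_)) (by positivity)
      have : x ∉ {x | l < U x} := by simpa using hb x
      simp [this]
    | succ n ih =>
      intro l hl hb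
      have i1 := ih (4 * l) (by linarith) fun x => (hb x).trans (le_of_eq (by ring))
      have i2 := sum_truncPotential_level_le hT₁ hT₂ hT₃ hw ht hν hδ hl
      have e : √(δ / (4 * l)) = √(δ / l) / 2 := by
        rw [show δ / (4 * l) = δ / l / 2 ^ 2 by ring, Real.sqrt_div' _ (by positivity),
          Real.sqrt_sq (by norm_num)]
      rw [e] at i1
      have hs : ∑ γ, ν γ * {x | l < U x}.indicator U γ ≤
          ∑ γ, ν γ * {x | l < U x ∧ U x ≤ 4 * l}.indicator U γ +
            ∑ γ, ν γ * {x | 4 * l < U x}.indicator U γ := by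
        rw [← Finset.sum_add_distrib]
        refine Finset.sum_le_sum fun x _ => ?_
        rw [← mul_add]
        refine mul_le_mul_of_nonneg_left ?_ (hν x)
        simp only [Set.indicator_apply, Set.mem_ofPred_eq]
        by_cases h1 : l < U x <;> by_cases h2 : U x ≤ 4 * l
        · simp [h1, h2, not_lt.2 h2]
        · simp [h1, h2, not_le.1 h2]
        · simp [h1, not_lt.2 h2]
        · simp only [h1, if_false, false_and, zero_add]
          split_ifs
          exacts [hU0 x, le_rfl]
      linarith
  have hl0 : 0 < l := by linarith
  obtain ⟨n, hn⟩ : ∃ n : ℕ, ∑ x, U x ≤ 4 ^ n * l := by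
    obtain ⟨n, hn⟩ := pow_unbounded_of_one_lt ((∑ x, U x) / l) (show (1 : ℝ) < 4 by norm_num)
    exact ⟨n, ((div_lt_iff₀ hl0).1 hn).le⟩
  exact main n l hl fun x =>
    (Finset.single_le_sum (fun y _ => hU0 y) (Finset.mem_univ x)).trans hn

end Key

/-! ### From the box condition to the hereditary condition, on any poset with small tails -/

section Generic

variable {P : Type*} [Fintype P] [PartialOrder P] {w μ ν : P → ℝ}

theorem sum_mul_potential (w ν ρ : P → ℝ) :
    ∑ γ, ρ γ * potential w ν γ = ∑ α, w α * adjHardy ν α * adjHardy ρ α :=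
  sum_mul_hardy _ _

theorem sum_mul_truncPotential (w ν : P → ℝ) (δ : ℝ) :
    ∑ γ, ν γ * truncPotential w ν δ γ =
      ∑ α, w α * {x | potential w ν x ≤ δ}.indicator (adjHardy ν) α ^ 2 := by
  classical
  refine (sum_mul_hardy _ _).trans (Finset.sum_congr rfl fun α _ => ?_)
  by_cases h : α ∈ {x | potential w ν x ≤ δ}
  · rw [Set.indicator_of_mem h]
    ring
  · rw [Set.indicator_of_notMem h]
    ring

/-- The energy of `ν` coming from the region of small potential is small. -/
theorem HasSmallTails.truncEnergy_le (hk : HasSmallTails w) (hw : ∀ α, 0 ≤ w α)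
    (hν : ∀ α, 0 ≤ ν α) {t : ℝ} (ht : 0 < t) (hE : energy w ν ≤ ∑ α, ν α) :
    ∑ α, w α * {x | potential w ν x ≤ t ^ 3}.indicator (adjHardy ν) α ^ 2 ≤
      73 * t * ∑ α, ν α := by
  classical
  have hm : 0 ≤ ∑ α, ν α := Finset.sum_nonneg fun α _ => hν α
  -- With δ = t³ and l = t one has √(δ/l) = t: the part U ≤ t costs t and the tail 72t. If 4δ ≤ l
  -- fails, then 73t ≥ 1 and the full energy bound suffices.
  by_cases h4 : 4 * t ^ 3 ≤ t
  · rw [← sum_mul_truncPotential]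
    have h1 := hk ν hν (t ^ 3) t (by positivity) h4
    have hs : √(t ^ 3 / t) = t := by
      rw [show t ^ 3 / t = t ^ 2 by field_simp, Real.sqrt_sq ht.le]
    rw [hs] at h1
    set U := truncPotential w ν (t ^ 3)
    have h2 : ∑ γ, ν γ * U γ ≤ t * ∑ γ, ν γ + ∑ γ, ν γ * {x | t < U x}.indicator U γ := by
      rw [Finset.mul_sum, ← Finset.sum_add_distrib]
      refine Finset.sum_le_sum fun x _ => ?_
      by_cases hx : t < U x
      · rw [Set.indicator_of_mem (show x ∈ {x | t < U x} from hx)]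
        have := mul_nonneg ht.le (hν x)
        linarith
      · rw [Set.indicator_of_notMem (show x ∉ {x | t < U x} from hx), mul_zero, add_zero,
          mul_comm]
        exact mul_le_mul_of_nonneg_right (not_lt.1 hx) (hν x)
    have h3 := mul_le_mul_of_nonneg_left hE (show 0 ≤ 72 * t by positivity)
    linarith
  · have ht2 : 1 ≤ 73 * t := by
      by_contra hcon
      push Not at hcon
      refine h4 ?_
      have : t ^ 2 ≤ 1 := pow_le_one₀ ht.le (by linarith)
      have : t ^ 2 ≤ 1 / 4 := by nlinarith
      nlinarith
    calc _ ≤ energy w ν := Finset.sum_le_sum fun x _ =>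
          mul_le_mul_of_nonneg_left (pow_le_pow_left₀
            (Set.indicator_nonneg (fun a _ => adjHardy_nonneg hν a) x)
            (Set.indicator_le_self' (fun a _ => adjHardy_nonneg hν a) x) 2) (hw x)
      _ ≤ 1 * ∑ α, ν α := by rwa [one_mul]
      _ ≤ _ := mul_le_mul_of_nonneg_right ht2 hm

theorem IsHereditaryBound.energy_le {C : ℝ} (h : IsHereditaryBound w μ C) (D : Set P) :
    energy w (D.indicator μ) ≤ C * ∑ α, D.indicator μ α := by
  classical
  have := h.2 (Finset.univ.filter (· ∈ D))
  rw [Finset.coe_filter_univ] at this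
  refine this.trans (le_of_eq ?_)
  rw [Finset.sum_filter]
  rfl

/-- The factor between the hereditary Carleson constant and the box constant. -/
noncomputable def boxFactor : ℝ :=
  4 / ((1 / 292) ^ 3 * ((1 / 292) ^ 3 / 2 * ((1 / 292) ^ 3 / 2 / 288) ^ 2))

theorem boxFactor_pos : 0 < boxFactor := by
  unfold boxFactor
  positivity

/-- Compare two bounds for ∑ w f² W, where f = I*ν and W is the part of V coming from {V > δ}. It is
at most c m / δ by the box condition and at least l m / 2, since at least half of the energy lies
where V > η = 2l and U ≤ l. Hence c ≥ lδ/2 = ηδ/4. -/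
theorem one_le_boxFactor_mul (hk : HasSmallTails w) (hw : ∀ α, 0 ≤ w α) (hμ : ∀ α, 0 ≤ μ α)
    (hH : IsHereditaryBound w μ 1) {c : ℝ} (hc : IsBoxBound w μ c) {S : Set P}
    (hpos : 0 < ∑ α, S.indicator μ α)
    (hext : energy w (S.indicator μ) = ∑ α, S.indicator μ α) :
    1 ≤ boxFactor * c := by
  classical
  set ν := S.indicator μ with hνdef
  have hν : ∀ α, 0 ≤ ν α := Set.indicator_nonneg fun α _ => hμ α
  have hνμ : ∀ α, ν α ≤ μ α := Set.indicator_le_self' fun α _ => hμ α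
  set m := ∑ α, ν α with hm
  set η : ℝ := (1 / 292) ^ 3 with hη
  set l : ℝ := η / 2 with hl
  set δ : ℝ := l * (l / 288) ^ 2 with hδ
  have hη0 : 0 < η := by positivity
  have hl0 : 0 < l := by positivity
  have hδ0 : 0 < δ := by positivity
  have hl1 : l ≤ 1 := by
    rw [hl, hη]
    norm_num
  have hδl : 4 * δ ≤ l := by
    have : (l / 288) ^ 2 ≤ 1 / 4 := by nlinarith
    rw [hδ]
    nlinarith
  have hb : boxFactor = 4 / (η * δ) := rfl
  clear_value δ l η
  set f := adjHardy ν with hf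
  set V := potential w ν with hV
  set U := truncPotential w ν δ with hU
  have hf0 : ∀ α, 0 ≤ f α := adjHardy_nonneg hν
  have hfμ : ∀ α, f α ≤ adjHardy μ α := fun α => adjHardy_mono fun a _ => hνμ a
  set D : Set P := {x | V x ≤ δ}ᶜ with hD
  have hDlow : ∀ {x y : P}, x ≤ y → y ∈ D → x ∈ D := fun {x y} hxy hy hx =>
    hy (isUpperSet_hardy_le (fun α => mul_nonneg (hw α) (hf0 α)) δ hxy hx)
  set W := hardy fun β => w β * D.indicator f β with hW
  have hVUW : ∀ x, V x = U x + W x := by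
    intro x
    change hardy _ x = hardy _ x + hardy _ x
    rw [← hardy_add]
    refine hardy_congr fun a _ => ?_
    rw [← mul_add, hD, Set.indicator_self_add_compl_apply]
  have hW0 : ∀ x, 0 ≤ W x := hardy_nonneg fun α =>
    mul_nonneg (hw α) (Set.indicator_nonneg (fun a _ => hf0 a) α)
  set X := ∑ α, w α * f α * adjHardy (D.indicator μ) α with hX
  have hμD : ∀ α, 0 ≤ D.indicator μ α := Set.indicator_nonneg fun α _ => hμ α
  -- the upper bound
  have up : ∑ α, (w α * f α ^ 2) * W α ≤ c * X := by
    rw [hW, sum_mul_hardy, hX, Finset.mul_sum]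
    refine Finset.sum_le_sum fun β _ => ?_
    by_cases hβ : β ∈ D
    · rw [Set.indicator_of_mem hβ]
      -- D is a down-set, so all the μ-mass below a point of D is counted; this is what lets X use
      -- only μ on D.
      have e1 : adjHardy (D.indicator μ) β = adjHardy μ β :=
        adjHardy_congr fun a ha => Set.indicator_of_mem (hDlow ha hβ) _
      have e2 : adjHardy (fun α => w α * f α ^ 2) β ≤ c * adjHardy μ β :=
        (adjHardy_mono fun a _ => mul_le_mul_of_nonneg_left
          (pow_le_pow_left₀ (hf0 a) (hfμ a) 2) (hw a)).trans (hc.2 β)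
      rw [e1]
      calc _ ≤ w β * f β * (c * adjHardy μ β) :=
            mul_le_mul_of_nonneg_left e2 (mul_nonneg (hw β) (hf0 β))
        _ = _ := by ring
    · rw [Set.indicator_of_notMem hβ, mul_zero, zero_mul]
      exact mul_nonneg hc.1 (mul_nonneg (mul_nonneg (hw β) (hf0 β)) (adjHardy_nonneg hμD β))
  have hX0 : 0 ≤ X := Finset.sum_nonneg fun β _ =>
    mul_nonneg (mul_nonneg (hw β) (hf0 β)) (adjHardy_nonneg hμD β)
  -- X is the integral of V over D against μ, so δ μ(D) ≤ X. Cauchy–Schwarz and the hereditary bound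
  -- on D give X² ≤ m μ(D), and μ(D) cancels.
  have hXm : δ * X ≤ m := by
    have x1 : δ * ∑ α, D.indicator μ α ≤ X := by
      rw [hX, ← sum_mul_potential, Finset.mul_sum]
      refine Finset.sum_le_sum fun α _ => ?_
      by_cases hα : α ∈ D
      · rw [mul_comm]
        exact mul_le_mul_of_nonneg_left (le_of_not_ge hα) (hμD α)
      · simp [hα]
    have x2 : X ^ 2 ≤ m * ∑ α, D.indicator μ α := by
      refine (sum_mul_mul_sq_le hw f (adjHardy (D.indicator μ))).trans ?_
      have := hH.energy_le D
      rw [one_mul] at this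
      exact mul_le_mul hext.le this (energy_nonneg hw _) hpos.le
    rcases hX0.eq_or_lt with h0 | h0
    · rw [← h0, mul_zero]
      exact hpos.le
    · refine le_of_mul_le_mul_right ?_ h0
      calc δ * X * X = δ * X ^ 2 := by ring
        _ ≤ δ * (m * ∑ α, D.indicator μ α) := mul_le_mul_of_nonneg_left x2 hδ0.le
        _ = m * (δ * ∑ α, D.indicator μ α) := by ring
        _ ≤ m * X := mul_le_mul_of_nonneg_left x1 hpos.le
  -- the lower bound
  set N : Set P := {x | l < U x} with hN
  have hNlow : ∀ {x y : P}, x ≤ y → y ∈ N → x ∈ N := fun {x y} hxy hy =>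
    lt_of_lt_of_le (show l < U y from hy) (hardy_anti (fun α => mul_nonneg (hw α)
      (Set.indicator_nonneg (fun a _ => hf0 a) α)) hxy)
  -- The value 1/292 makes 73t equal to 1/4.
  have low1 : ∑ α, w α * {x | V x ≤ η}.indicator f α ^ 2 ≤ m / 4 := by
    have := hk.truncEnergy_le hw hν (t := 1 / 292) (by norm_num) hext.le
    rw [← hη] at this
    refine this.trans (le_of_eq ?_)
    rw [hm]
    ring
  -- N is a down-set, so f on N is produced by ν on N. The hereditary bound reduces the claim to the
  -- mass of N, which the tail estimate bounds by Chebyshev; δ was chosen so that 72 √(δ/l) = l/4.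
  have low2 : ∑ α, w α * N.indicator f α ^ 2 ≤ m / 4 := by
    have y1 : ∑ α, w α * N.indicator f α ^ 2 ≤ energy w (N.indicator ν) := by
      refine Finset.sum_le_sum fun α _ => mul_le_mul_of_nonneg_left ?_ (hw α)
      by_cases hα : α ∈ N
      · rw [Set.indicator_of_mem hα, hf]
        exact le_of_eq (congrArg (· ^ 2) (adjHardy_congr fun a ha =>
          (Set.indicator_of_mem (hNlow ha hα) ν).symm))
      · rw [Set.indicator_of_notMem hα, zero_pow two_ne_zero]
        exact sq_nonneg _
    have y2 := hH.energy_le (N ∩ S)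
    rw [← Set.indicator_indicator, one_mul] at y2
    have y3 := hk ν hν δ l hδ0 hδl
    have y4 : l * ∑ α, N.indicator ν α ≤ ∑ γ, ν γ * N.indicator U γ := by
      rw [Finset.mul_sum]
      refine Finset.sum_le_sum fun α _ => ?_
      by_cases hα : α ∈ N
      · rw [Set.indicator_of_mem hα, Set.indicator_of_mem hα, mul_comm]
        exact mul_le_mul_of_nonneg_left (show l < U α from hα).le (hν α)
      · simp [hα]
    have hs : √(δ / l) = l / 288 := by
      rw [show δ / l = (l / 288) ^ 2 by rw [hδ]; field_simp, Real.sqrt_sq (by positivity)]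
    rw [hs, hext] at y3
    have y5 : l * ∑ α, N.indicator ν α ≤ l * (m / 4) :=
      (y4.trans y3).trans (le_of_eq (by ring))
    exact (y1.trans y2).trans (le_of_mul_le_mul_left y5 hl0)
  have low3 : l * (m / 2) ≤ ∑ α, (w α * f α ^ 2) * W α := by
    have z : l * energy w ν - l * ∑ α, w α * {x | V x ≤ η}.indicator f α ^ 2 -
        l * ∑ α, w α * N.indicator f α ^ 2 ≤ ∑ α, (w α * f α ^ 2) * W α := by
      rw [energy, Finset.mul_sum, Finset.mul_sum, Finset.mul_sum, ← Finset.sum_sub_distrib,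
        ← Finset.sum_sub_distrib]
      refine Finset.sum_le_sum fun α _ => ?_
      have p0 : 0 ≤ w α * f α ^ 2 := mul_nonneg (hw α) (sq_nonneg _)
      have p1 : 0 ≤ w α * {x | V x ≤ η}.indicator f α ^ 2 := mul_nonneg (hw α) (sq_nonneg _)
      have p2 : 0 ≤ w α * N.indicator f α ^ 2 := mul_nonneg (hw α) (sq_nonneg _)
      have p3 := mul_nonneg p0 (hW0 α)
      have p4 := mul_nonneg hl0.le p1
      have p5 := mul_nonneg hl0.le p2
      by_cases hα : V α ≤ η
      · rw [Set.indicator_of_mem (show α ∈ {x | V x ≤ η} from hα)] at p4 ⊢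
        linarith
      · by_cases hα2 : α ∈ N
        · rw [Set.indicator_of_mem hα2] at p5 ⊢
          linarith
        · have hU1 : U α ≤ l := not_lt.1 hα2
          have hW1 : l ≤ W α := by
            have := hVUW α
            have := not_le.1 hα
            linarith
          have := mul_le_mul_of_nonneg_left hW1 p0
          change l * (w α * f α ^ 2) - _ - _ ≤ _
          linarith
    rw [hext] at z
    have z1 := mul_le_mul_of_nonneg_left low1 hl0.le
    have z2 := mul_le_mul_of_nonneg_left low2 hl0.le
    linarith
  have fin1 : l * (m / 2) * δ ≤ c * m := by
    calc l * (m / 2) * δ ≤ c * X * δ := mul_le_mul_of_nonneg_right (low3.trans up) hδ0.le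
      _ = c * (δ * X) := by ring
      _ ≤ c * m := mul_le_mul_of_nonneg_left hXm hc.1
  have fin2 : l / 2 * δ ≤ c := by
    refine le_of_mul_le_mul_right ?_ hpos
    calc l / 2 * δ * m = l * (m / 2) * δ := by ring
      _ ≤ c * m := fin1
  rw [hb, div_mul_eq_mul_div, le_div_iff₀ (by positivity)]
  calc 1 * (η * δ) = 4 * (l / 2 * δ) := by rw [hl]; ring
    _ ≤ 4 * c := by linarith

/-- There are finitely many test sets, so the hereditary ratio is maximised by some S; dividing w by
the maximum reduces to the normalised case. Hence small tails are assumed for all positive multiples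
of w. -/
theorem IsBoxBound.isHereditaryBound (hk : ∀ s : ℝ, 0 < s → HasSmallTails fun α => s * w α)
    (hw : ∀ α, 0 ≤ w α) (hμ : ∀ α, 0 ≤ μ α) {c : ℝ} (hc : IsBoxBound w μ c) :
    IsHereditaryBound w μ (boxFactor * c) := by
  classical
  set r : Finset P → ℝ := fun E => energy w ((E : Set P).indicator μ) / ∑ α ∈ E, μ α with hr
  obtain ⟨S, -, hS⟩ := Finset.exists_max_image Finset.univ r Finset.univ_nonempty
  have hsum : ∀ E : Finset P, ∑ α, (E : Set P).indicator μ α = ∑ α ∈ E, μ α := fun E =>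
    Finset.sum_indicator_subset μ (Finset.subset_univ E)
  have hbd : ∀ E : Finset P,
      energy w ((E : Set P).indicator μ) ≤ r S * ∑ α ∈ E, μ α := by
    intro E
    rcases (Finset.sum_nonneg fun α (_ : α ∈ E) => hμ α).eq_or_lt with h0 | h0
    · have hz : ∀ α ∈ E, μ α = 0 := (Finset.sum_eq_zero_iff_of_nonneg fun α _ => hμ α).1 h0.symm
      rw [← h0, mul_zero]
      refine le_of_eq (Finset.sum_eq_zero fun α _ => ?_)
      rw [adjHardy_eq_zero, zero_pow two_ne_zero, mul_zero]
      intro a _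
      by_cases ha : a ∈ E
      · simp [ha, hz a ha]
      · simp [ha]
    · exact (div_le_iff₀ h0).1 (hS E (Finset.mem_univ _))
  have hr0 : 0 ≤ r S := div_nonneg (energy_nonneg hw _) (Finset.sum_nonneg fun α _ => hμ α)
  refine ⟨mul_nonneg boxFactor_pos.le hc.1, fun E => (hbd E).trans
    (mul_le_mul_of_nonneg_right ?_ (Finset.sum_nonneg fun α _ => hμ α))⟩
  rcases hr0.eq_or_lt with h0 | h0
  · rw [← h0]
    exact mul_nonneg boxFactor_pos.le hc.1
  set s : ℝ := (r S)⁻¹ with hs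
  have hs0 : 0 < s := inv_pos.2 h0
  have hsr : s * r S = 1 := inv_mul_cancel₀ h0.ne'
  have hen : ∀ ν : P → ℝ, energy (fun α => s * w α) ν = s * energy w ν := fun ν => by
    simp only [energy, Finset.mul_sum, mul_assoc]
  have hSpos : 0 < ∑ α ∈ S, μ α := by
    refine lt_of_le_of_ne (Finset.sum_nonneg fun α _ => hμ α) fun h => ?_
    rw [hr] at h0
    simp only [← h, div_zero, lt_irrefl] at h0
  have H1 : IsHereditaryBound (fun α => s * w α) μ 1 := by
    refine ⟨zero_le_one, fun E => ?_⟩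
    change energy (fun α => s * w α) _ ≤ _
    rw [hen, ← hsr, mul_assoc]
    exact mul_le_mul_of_nonneg_left (hbd E) hs0.le
  have B1 : IsBoxBound (fun α => s * w α) μ (s * c) := by
    refine ⟨mul_nonneg hs0.le hc.1, fun β => ?_⟩
    have := mul_le_mul_of_nonneg_left (hc.2 β) hs0.le
    rw [Finset.mul_sum, ← mul_assoc] at this
    simpa only [mul_assoc] using this
  have := one_le_boxFactor_mul (hk s hs0) (fun α => mul_nonneg hs0.le (hw α)) hμ H1 B1
    (S := (S : Set P)) (by rwa [hsum]) (by
      rw [hen, hsum, hs, hr, inv_div, div_mul_cancel₀]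
      intro h
      rw [hr] at h0
      simp only [h, zero_div, lt_irrefl] at h0)
  calc r S = r S * 1 := (mul_one _).symm
    _ ≤ r S * (boxFactor * (s * c)) := mul_le_mul_of_nonneg_left this hr0
    _ = s * r S * (boxFactor * c) := by ring
    _ = boxFactor * c := by rw [hsr, one_mul]

end Generic

/-! ### From the hereditary condition to the embedding -/

section Embedding

variable {P : Type*} [Fintype P] [PartialOrder P] {w μ : P → ℝ}

theorem adjHardy_add_mul (p q : P → ℝ) (ε : ℝ) (x : P) :
    adjHardy (fun a => p a + ε * q a) x = adjHardy p x + ε * adjHardy q x := by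
  simp only [adjHardy, Finset.sum_add_distrib, Finset.mul_sum]

theorem energy_add_mul (w p q : P → ℝ) (ε : ℝ) :
    energy w (fun a => p a + ε * q a) =
      energy w p + 2 * ε * ∑ γ, q γ * potential w p γ + ε ^ 2 * energy w q := by
  simp only [sum_mul_potential, energy, adjHardy_add_mul, Finset.mul_sum]
  rw [← Finset.sum_add_distrib, ← Finset.sum_add_distrib]
  exact Finset.sum_congr rfl fun α _ => by ring

theorem energy_const_mul (w p : P → ℝ) (c : ℝ) :
    energy w (fun a => c * p a) = c ^ 2 * energy w p := by
  simp only [energy, adjHardy_const_mul, Finset.mul_sum]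
  exact Finset.sum_congr rfl fun α _ => by ring

theorem energy_le_energy_abs (hw : ∀ α, 0 ≤ w α) (p : P → ℝ) :
    energy w p ≤ energy w fun a => |p a| := by
  refine Finset.sum_le_sum fun α _ => mul_le_mul_of_nonneg_left ?_ (hw α)
  rw [← sq_abs]
  exact pow_le_pow_left₀ (abs_nonneg _) (Finset.abs_sum_le_sum_abs _ _) 2

theorem eq_zero_of_forall_quadratic_nonneg {b d : ℝ} (h : ∀ ε : ℝ, 0 ≤ 2 * ε * b + ε ^ 2 * d) :
    b = 0 := by
  have hd : 0 < |d| + 1 := by positivity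
  have h1 := h (-b / (|d| + 1))
  have h2 : 2 * (-b / (|d| + 1)) * b + (-b / (|d| + 1)) ^ 2 * d =
      (b ^ 2 * (d - 2 * (|d| + 1))) / (|d| + 1) ^ 2 := by
    field_simp
    ring
  rw [h2] at h1
  have h3 : 0 ≤ b ^ 2 * (d - 2 * (|d| + 1)) := by
    by_contra hcon
    exact absurd h1 (not_le.2 (div_neg_of_neg_of_pos (not_le.1 hcon) (by positivity)))
  have h4 : d - 2 * (|d| + 1) < 0 := by
    have := le_abs_self d
    linarith [abs_nonneg d]
  by_contra hb
  exact absurd h3 (not_le.2 (mul_neg_of_pos_of_neg (by positivity) h4))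

theorem continuous_energy_mul (w m : P → ℝ) :
    Continuous fun φ : P → ℝ => energy w fun a => φ a * m a := by
  unfold energy adjHardy
  fun_prop

/-- The best embedding constant is attained at a nonnegative function `ψ`, which is then an
eigenfunction of `ψ ↦ potential w (ψ μ)`. -/
theorem exists_extremal (hw : ∀ α, 0 ≤ w α) (hμ : ∀ α, 0 ≤ μ α) :
    IsEmbeddingBound w μ 0 ∨ ∃ (ψ : P → ℝ) (c : ℝ), 0 < c ∧ IsEmbeddingBound w μ c ∧
      (∀ γ, 0 ≤ ψ γ) ∧ (∀ γ, μ γ ≠ 0 → potential w (fun a => ψ a * μ a) γ = c * ψ γ) ∧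
      ∑ γ, ψ γ ^ 2 * μ γ = 1 := by
  classical
  rcases isEmpty_or_nonempty P with hP | hP
  · exact Or.inl ⟨le_rfl, fun ψ => by simp⟩
  set K : Set (P → ℝ) := {φ | ∑ γ, φ γ ^ 2 = 1} with hK
  have hKc : IsCompact K := by
    refine (isCompact_univ_pi fun _ : P =>
      isCompact_Icc (a := (-1 : ℝ)) (b := 1)).of_isClosed_subset (isClosed_eq (by fun_prop) continuous_const) fun φ hφ γ _ => ?_
    have h1 : φ γ ^ 2 ≤ 1 := by
      rw [← show ∑ γ, φ γ ^ 2 = 1 from hφ]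
      exact Finset.single_le_sum (f := fun γ => φ γ ^ 2) (fun _ _ => sq_nonneg _)
        (Finset.mem_univ γ)
    exact abs_le.1 ((sq_le_one_iff_abs_le_one _).1 h1)
  have hKn : K.Nonempty := by
    obtain ⟨γ₀⟩ := hP
    refine ⟨Pi.single γ₀ 1, ?_⟩
    change ∑ γ, (Pi.single γ₀ (1 : ℝ) : P → ℝ) γ ^ 2 = 1
    rw [Finset.sum_eq_single γ₀]
    · simp
    · intro b _ hb
      simp [hb]
    · simp
  -- The substitution φ = ψ√μ turns the extremal problem into maximising a quadratic form on the
  -- unit sphere, which also makes sense where μ vanishes.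
  set m : P → ℝ := fun a => √(μ a) with hm
  have hm2 : ∀ a, m a * m a = μ a := fun a => Real.mul_self_sqrt (hμ a)
  have hm0 : ∀ a, 0 ≤ m a := fun a => Real.sqrt_nonneg _
  obtain ⟨φ₀, hφ₀, hmax₀⟩ := hKc.exists_isMaxOn hKn (continuous_energy_mul w m).continuousOn
  set φ : P → ℝ := fun a => |φ₀ a| with hφdef
  have hφ : ∑ γ, φ γ ^ 2 = 1 := by
    simp only [hφdef, sq_abs]
    exact hφ₀
  set c := energy w fun a => φ a * m a with hc
  have hmax : ∀ χ ∈ K, energy w (fun a => χ a * m a) ≤ c := by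
    intro χ hχ
    refine (hmax₀ hχ).trans ((energy_le_energy_abs hw _).trans (le_of_eq ?_))
    rw [hc]
    congr 1
    funext a
    rw [abs_mul, abs_of_nonneg (hm0 a)]
  have hc0 : 0 ≤ c := energy_nonneg hw _
  have hbd : ∀ χ : P → ℝ, energy w (fun a => χ a * m a) ≤ c * ∑ γ, χ γ ^ 2 := by
    intro χ
    rcases (Finset.sum_nonneg fun γ (_ : γ ∈ Finset.univ) => sq_nonneg (χ γ)).eq_or_lt with h | h
    · have hz : ∀ γ, χ γ = 0 := fun γ => by
        have := (Finset.sum_eq_zero_iff_of_nonneg fun γ _ => sq_nonneg (χ γ)).1 h.symm γ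
          (Finset.mem_univ _)
        exact pow_eq_zero_iff two_ne_zero |>.1 this
      rw [← h, mul_zero]
      refine le_of_eq (Finset.sum_eq_zero fun α _ => ?_)
      rw [adjHardy_eq_zero fun a _ => by rw [hz a, zero_mul], zero_pow two_ne_zero, mul_zero]
    · set q := √(∑ γ, χ γ ^ 2) with hq
      have hq0 : 0 < q := Real.sqrt_pos.2 h
      have hq2 : q ^ 2 = ∑ γ, χ γ ^ 2 := Real.sq_sqrt h.le
      have h1 := hmax (fun a => q⁻¹ * χ a) (by
        change ∑ γ, (q⁻¹ * χ γ) ^ 2 = 1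
        simp only [mul_pow]
        rw [← Finset.mul_sum, ← hq2, ← mul_pow, inv_mul_cancel₀ hq0.ne', one_pow])
      simp only [mul_assoc] at h1
      rw [energy_const_mul, inv_pow, inv_mul_le_iff₀ (by positivity), hq2] at h1
      rw [mul_comm]
      exact h1
  have hemb : IsEmbeddingBound w μ c := by
    refine ⟨hc0, fun ψ => ?_⟩
    have := hbd fun a => ψ a * m a
    simp only [mul_assoc, hm2, mul_pow] at this
    simp only [sq_abs]
    refine this.trans (le_of_eq (congrArg _ (Finset.sum_congr rfl fun a _ => ?_)))
    rw [sq (m a), hm2]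
  rcases hc0.eq_or_lt with h0 | hcpos
  · left
    rw [h0]
    exact hemb
  right
  set V := potential w fun a => φ a * m a with hV
  -- First-order condition at the maximum, obtained by varying φ in the coordinate γ.
  have heig : ∀ γ, c * φ γ = m γ * V γ := by
    intro γ
    rw [← sub_eq_zero]
    refine eq_zero_of_forall_quadratic_nonneg
      (d := c - energy w fun a => (Pi.single γ (m γ) : P → ℝ) a) fun ε => ?_
    have h1 := hbd fun a => φ a + ε * (Pi.single γ (1 : ℝ) : P → ℝ) a
    have e1 : (fun a => (φ a + ε * (Pi.single γ (1 : ℝ) : P → ℝ) a) * m a) =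
        fun a => φ a * m a + ε * (Pi.single γ (m γ) : P → ℝ) a := by
      funext a
      by_cases ha : a = γ
      · subst ha
        simp
        ring
      · simp [ha]
    have e2 : ∑ a, (φ a + ε * (Pi.single γ (1 : ℝ) : P → ℝ) a) ^ 2 = 1 + 2 * ε * φ γ + ε ^ 2 := by
      have : ∀ a, (φ a + ε * (Pi.single γ (1 : ℝ) : P → ℝ) a) ^ 2 =
          φ a ^ 2 + if a = γ then 2 * ε * φ γ + ε ^ 2 else 0 := by
        intro a
        by_cases ha : a = γ
        · subst ha
          simp
          ring
        · simp [ha]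
      simp only [this, Finset.sum_add_distrib, hφ]
      simp
      ring
    have e3 : ∑ a, (Pi.single γ (m γ) : P → ℝ) a * V a = m γ * V γ := by
      rw [Finset.sum_eq_single γ]
      · simp
      · intro b _ hb
        simp [hb]
      · simp
    rw [e1, energy_add_mul, e2, ← hV, e3, ← hc] at h1
    linarith
  -- This makes the later division by √μ harmless: where μ = 0 the quotient is 0/0, read as 0.
  have hz : ∀ γ, μ γ = 0 → φ γ = 0 := by
    intro γ hγ
    have := heig γ
    rw [hm] at this
    simp only [hγ, Real.sqrt_zero, zero_mul] at this
    exact (mul_eq_zero.1 this).resolve_left hcpos.ne'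
  have hmne : ∀ γ, μ γ ≠ 0 → m γ ≠ 0 := fun γ hγ h => hγ (by rw [← hm2, h, zero_mul])
  have hψ : (fun a => φ a / m a * μ a) = fun a => φ a * m a := by
    funext a
    by_cases ha : μ a = 0
    · rw [ha, hz a ha]
      simp
    · have := hmne a ha
      rw [← hm2 a]
      field_simp
  refine ⟨fun a => φ a / m a, c, hcpos, hemb, fun γ => div_nonneg (abs_nonneg _) (hm0 γ),
    fun γ hγ => ?_, ?_⟩
  · have := hmne γ hγ
    rw [hψ, ← hV, ← mul_div_assoc, heig γ]
    field_simp
  · rw [← hφ]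
    refine Finset.sum_congr rfl fun a _ => ?_
    by_cases ha : μ a = 0
    · rw [ha, hz a ha]
      simp
    · have := hmne a ha
      rw [← hm2 a]
      field_simp

theorem sum_half_pow_le {S : Finset ℤ} {g : ℤ → ℕ} (hg : Set.InjOn g S) :
    ∑ j ∈ S, (1 / 2 : ℝ) ^ g j ≤ 2 := by
  rw [← Finset.sum_image (f := fun n => (1 / 2 : ℝ) ^ n) hg]
  exact (summable_geometric_two.sum_le_tsum _ fun n _ => by positivity).trans_eq
    tsum_geometric_two

theorem sum_half_pow_natAbs_le (S : Finset ℤ) (i : ℤ) :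
    ∑ j ∈ S, (1 / 2 : ℝ) ^ (i - j).natAbs ≤ 4 := by
  classical
  rw [← Finset.sum_filter_add_sum_filter_not S (· ≤ i)]
  have h1 : ∑ j ∈ S with j ≤ i, (1 / 2 : ℝ) ^ (i - j).natAbs ≤ 2 := by
    refine sum_half_pow_le fun a ha b hb hab => ?_
    have ha := (Finset.mem_filter.1 ha).2
    have hb := (Finset.mem_filter.1 hb).2
    omega
  have h2 : ∑ j ∈ S with ¬j ≤ i, (1 / 2 : ℝ) ^ (i - j).natAbs ≤ 2 := by
    refine sum_half_pow_le fun a ha b hb hab => ?_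
    have ha := (Finset.mem_filter.1 ha).2
    have hb := (Finset.mem_filter.1 hb).2
    omega
  linarith

/-- Almost orthogonality of the restrictions of `μ` to sets on which the potential of the
other restriction is small. -/
theorem HasSmallTails.sum_mul_adjHardy_sq_le (hk : HasSmallTails w) (hw : ∀ α, 0 ≤ w α)
    (hμ : ∀ α, 0 ≤ μ α) (hH : IsHereditaryBound w μ 1) (D D' : Set P) {t : ℝ} (ht : 0 < t)
    (hV : ∀ γ ∈ D', μ γ ≠ 0 → potential w (D.indicator μ) γ ≤ t ^ 3) :
    (∑ α, w α * adjHardy (D.indicator μ) α * adjHardy (D'.indicator μ) α) ^ 2 ≤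
      73 * t * (∑ α, D.indicator μ α) * ∑ α, D'.indicator μ α := by
  classical
  have hμD : ∀ α, 0 ≤ D.indicator μ α := Set.indicator_nonneg fun α _ => hμ α
  have h1 := hH.energy_le D
  have h2 := hH.energy_le D'
  rw [one_mul] at h1 h2
  set A := {x | potential w (D.indicator μ) x ≤ t ^ 3} with hA
  -- The set A is an up-set containing the μ-charged points of D', so outside A the second factor
  -- vanishes and the first may be truncated for free.
  have e : ∑ α, w α * adjHardy (D.indicator μ) α * adjHardy (D'.indicator μ) α =
      ∑ α, w α * A.indicator (adjHardy (D.indicator μ)) α * adjHardy (D'.indicator μ) α := by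
    refine Finset.sum_congr rfl fun α _ => ?_
    by_cases hα : α ∈ A
    · rw [Set.indicator_of_mem hα]
    · have : adjHardy (D'.indicator μ) α = 0 := by
        refine adjHardy_eq_zero fun a ha => ?_
        by_contra hne
        have haD : a ∈ D' := by
          by_contra h
          exact hne (Set.indicator_of_notMem h _)
        rw [Set.indicator_of_mem haD] at hne
        exact hα (isUpperSet_hardy_le (fun β => mul_nonneg (hw β) (adjHardy_nonneg hμD β))
          (t ^ 3) ha (hV a haD hne))
      rw [this, mul_zero, mul_zero]
  rw [e]
  refine (sum_mul_mul_sq_le hw _ _).trans (mul_le_mul (hk.truncEnergy_le hw hμD ht h1) h2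
    (energy_nonneg hw _) ?_)
  have : 0 ≤ ∑ α, D.indicator μ α := Finset.sum_nonneg fun α _ => hμD α
  positivity

/-- Decompose ψ into levels of ratio 64. The pairing of two levels at distance n is at most a
constant times c^(1/6) 2^(-n) times the sum of their contributions to ∑ ψ² μ = 1. Summing over pairs
bounds the energy, which equals c, by 64² · 72 · c^(1/6). -/
theorem le_of_eigenfunction (hk : HasSmallTails w) (hw : ∀ α, 0 ≤ w α)
    (hμ : ∀ α, 0 ≤ μ α) (hH : IsHereditaryBound w μ 1) {ψ : P → ℝ} {c : ℝ} (hc : 0 < c)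
    (hψ : ∀ γ, 0 ≤ ψ γ)
    (heig : ∀ γ, μ γ ≠ 0 → potential w (fun a => ψ a * μ a) γ = c * ψ γ)
    (hnorm : ∑ γ, ψ γ ^ 2 * μ γ = 1) : c ≤ 13 ^ 6 := by
  classical
  -- The sixth root s is natural below: the potential bound is t³, and Cauchy–Schwarz leaves √t.
  set ν : P → ℝ := fun a => ψ a * μ a with hν
  have hν0 : ∀ a, 0 ≤ ν a := fun a => mul_nonneg (hψ a) (hμ a)
  obtain ⟨s, hs0, hs6⟩ : ∃ s : ℝ, 0 < s ∧ s ^ 6 = c :=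
    ⟨c ^ ((1 : ℝ) / 6), Real.rpow_pos_of_pos hc _, by
      rw [← Real.rpow_natCast, ← Real.rpow_mul hc.le]
      norm_num⟩
  -- Positivity must be required, since `Int.log` has a default value at 0. The base is 64 = 4³, so
  -- that t decays like 4^(-n) and √t like 2^(-n).
  set F : ℤ → Set P := fun i => {γ | 0 < ψ γ ∧ Int.log 64 (ψ γ) = i} with hF
  have hFlow : ∀ i, ∀ γ ∈ F i, (64 : ℝ) ^ i ≤ ψ γ := by
    rintro i γ ⟨h1, h2⟩
    rw [← h2]
    exact_mod_cast Int.zpow_log_le_self (b := 64) (by norm_num) h1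
  have hFup : ∀ i, ∀ γ ∈ F i, ψ γ ≤ 64 * (64 : ℝ) ^ i := by
    rintro i γ ⟨h1, h2⟩
    have := (Int.lt_zpow_succ_log_self (b := 64) (by norm_num) (ψ γ)).le
    rw [h2] at this
    rw [mul_comm, ← zpow_add_one₀ (by norm_num)]
    exact_mod_cast this
  set L : Finset ℤ := Finset.univ.image fun γ => Int.log 64 (ψ γ) with hL
  have hdecomp : ∀ (g : P → ℝ) (γ : P), (ψ γ = 0 → g γ = 0) →
      ∑ i ∈ L, (F i).indicator g γ = g γ := by
    intro g γ h
    rcases (hψ γ).eq_or_lt with h0 | h0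
    · rw [h h0.symm]
      refine Finset.sum_eq_zero fun i _ => Set.indicator_of_notMem (fun hi => ?_) _
      exact (h0 ▸ hi.1).false
    · rw [Finset.sum_eq_single (Int.log 64 (ψ γ))]
      · exact Set.indicator_of_mem (show γ ∈ F _ from ⟨h0, rfl⟩) _
      · intro i _ hi
        exact Set.indicator_of_notMem (fun hi' => hi hi'.2.symm) _
      · exact fun h => absurd (Finset.mem_image_of_mem _ (Finset.mem_univ γ)) h
  set f : ℤ → P → ℝ := fun i => adjHardy ((F i).indicator μ) with hf
  have hμF : ∀ i α, 0 ≤ (F i).indicator μ α := fun i => Set.indicator_nonneg fun α _ => hμ α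
  have hf0 : ∀ i α, 0 ≤ f i α := fun i => adjHardy_nonneg (hμF i)
  have hνf : ∀ α, adjHardy ν α ≤ ∑ i ∈ L, 64 * (64 : ℝ) ^ i * f i α := by
    intro α
    have h1 : adjHardy ν α = ∑ i ∈ L, adjHardy ((F i).indicator ν) α := by
      simp only [adjHardy]
      rw [Finset.sum_comm]
      refine Finset.sum_congr rfl fun γ _ => (hdecomp ν γ fun h => ?_).symm
      rw [hν]
      simp [h]
    rw [h1]
    refine Finset.sum_le_sum fun i _ => ?_
    rw [hf, ← adjHardy_const_mul]
    refine adjHardy_mono fun a _ => ?_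
    by_cases ha : a ∈ F i
    · rw [Set.indicator_of_mem ha, Set.indicator_of_mem ha]
      exact mul_le_mul_of_nonneg_right (hFup i a ha) (hμ a)
    · simp [ha]
  set e : ℤ → ℝ := fun i => ((64 : ℝ) ^ i) ^ 2 * ∑ γ, (F i).indicator μ γ with he
  have hm0 : ∀ i, 0 ≤ ∑ γ, (F i).indicator μ γ := fun i => Finset.sum_nonneg fun α _ => hμF i α
  have he0 : ∀ i, 0 ≤ e i := fun i => mul_nonneg (sq_nonneg _) (hm0 i)
  have hesum : ∑ i ∈ L, e i ≤ 1 := by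
    rw [← hnorm]
    calc ∑ i ∈ L, e i ≤ ∑ i ∈ L, ∑ γ, (F i).indicator (fun γ => ψ γ ^ 2 * μ γ) γ := by
          refine Finset.sum_le_sum fun i _ => ?_
          simp only [he, Finset.mul_sum]
          refine Finset.sum_le_sum fun γ _ => ?_
          by_cases hγ : γ ∈ F i
          · rw [Set.indicator_of_mem hγ, Set.indicator_of_mem hγ]
            exact mul_le_mul_of_nonneg_right
              (pow_le_pow_left₀ (by positivity) (hFlow i γ hγ) 2) (hμ γ)
          · simp [hγ]
      _ = ∑ γ, ψ γ ^ 2 * μ γ := by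
          rw [Finset.sum_comm]
          refine Finset.sum_congr rfl fun γ _ => hdecomp _ γ fun h => ?_
          simp [h]
  -- almost orthogonality of different levels
  have pair : ∀ i j, j ≤ i → (64 : ℝ) ^ i * (64 : ℝ) ^ j * ∑ α, w α * f i α * f j α ≤
      9 * s * (1 / 2) ^ (i - j).natAbs * (e i + e j) := by
    intro i j hij
    obtain ⟨n, hn⟩ : ∃ n : ℕ, i = j + n := ⟨(i - j).natAbs, by omega⟩
    have hnn : (i - j).natAbs = n := by omega
    rw [hnn]
    have hpow : (64 : ℝ) ^ i = 64 ^ j * 64 ^ n := by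
      rw [hn, zpow_add₀ (by norm_num), zpow_natCast]
    set t : ℝ := s ^ 2 * (4 * (1 / 4) ^ n) with ht
    have ht0 : 0 < t := by positivity
    have ht3 : t ^ 3 = c * (64 * (1 / 64) ^ n) := by
      rw [ht, ← hs6, show (1 / 64 : ℝ) = (1 / 4) ^ 3 by norm_num, ← pow_mul, mul_pow, mul_pow,
        ← pow_mul, ← pow_mul, mul_comm 3 n]
      norm_num
    -- Since 64^i 1_{F i} ≤ ψ, the potential of level i is at most 64^(-i) c ψ, and ψ ≤ 64^(j+1) on
    -- level j; this is exactly t³.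
    have hpot : ∀ γ ∈ F j, μ γ ≠ 0 → potential w ((F i).indicator μ) γ ≤ t ^ 3 := by
      intro γ hγ hμγ
      have h1 : (64 : ℝ) ^ i * potential w ((F i).indicator μ) γ ≤ potential w ν γ := by
        rw [potential, ← hardy_const_mul]
        refine hardy_mono fun a _ => ?_
        rw [mul_left_comm, ← adjHardy_const_mul]
        refine mul_le_mul_of_nonneg_left (adjHardy_mono fun b _ => ?_) (hw a)
        by_cases hb : b ∈ F i
        · rw [Set.indicator_of_mem hb]
          exact mul_le_mul_of_nonneg_right (hFlow i b hb) (hμ b)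
        · rw [Set.indicator_of_notMem hb, mul_zero]
          exact hν0 b
      rw [heig γ hμγ] at h1
      have h2 := mul_le_mul_of_nonneg_left (hFup j γ hγ) hc.le
      have h3 : (0 : ℝ) < 64 ^ i := by positivity
      refine le_of_mul_le_mul_left ((h1.trans h2).trans (le_of_eq ?_)) h3
      rw [ht3, hpow, one_div, inv_pow]
      field_simp
    have hsq := hk.sum_mul_adjHardy_sq_le hw hμ hH (F i) (F j) ht0 hpot
    change (∑ α, w α * f i α * f j α) ^ 2 ≤ _ at hsq
    set X := ∑ α, w α * f i α * f j α
    refine le_of_sq_le_sq ?_ (mul_nonneg (by positivity) (add_nonneg (he0 i) (he0 j)))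
    have hq : ((1 / 2 : ℝ) ^ n) ^ 2 = (1 / 4) ^ n := by
      rw [← pow_mul, mul_comm, pow_mul]
      norm_num
    calc ((64 : ℝ) ^ i * (64 : ℝ) ^ j * X) ^ 2
        = ((64 : ℝ) ^ i) ^ 2 * ((64 : ℝ) ^ j) ^ 2 * X ^ 2 := by ring
      _ ≤ ((64 : ℝ) ^ i) ^ 2 * ((64 : ℝ) ^ j) ^ 2 * (73 * t * (∑ α, (F i).indicator μ α) *
            ∑ α, (F j).indicator μ α) := mul_le_mul_of_nonneg_left hsq (by positivity)
      _ = 73 * s ^ 2 * (1 / 4) ^ n * (4 * (e i * e j)) := by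
          rw [ht, he]
          ring
      -- Rounding 73 up to 9² makes the right side a perfect square.
      _ ≤ 81 * s ^ 2 * (1 / 4) ^ n * (e i + e j) ^ 2 := by
          refine mul_le_mul ?_ ?_ (mul_nonneg (by norm_num) (mul_nonneg (he0 i) (he0 j)))
            (by positivity)
          · have : 0 ≤ s ^ 2 * (1 / 4) ^ n := by positivity
            linarith
          · linarith [sq_nonneg (e i - e j), sq_nonneg (e i + e j)]
      _ = (9 * s * (1 / 2) ^ n * (e i + e j)) ^ 2 := by
          rw [← hq]
          ring
  have pair' : ∀ i j, (64 : ℝ) ^ i * (64 : ℝ) ^ j * ∑ α, w α * f i α * f j α ≤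
      9 * s * (1 / 2) ^ (i - j).natAbs * (e i + e j) := by
    intro i j
    rcases le_total j i with h | h
    · exact pair i j h
    · have := pair j i h
      rw [mul_comm ((64 : ℝ) ^ j), add_comm (e j), ← Int.natAbs_neg, neg_sub] at this
      refine le_of_eq_of_le (congrArg _ (Finset.sum_congr rfl fun α _ => ?_)) this
      ring
  have henergy : energy w ν = c := by
    calc energy w ν = ∑ γ, ν γ * potential w ν γ := by
          rw [sum_mul_potential, energy]
          exact Finset.sum_congr rfl fun α _ => by ring
      _ = c * ∑ γ, ψ γ ^ 2 * μ γ := by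
          rw [Finset.mul_sum]
          refine Finset.sum_congr rfl fun γ _ => ?_
          by_cases hγ : μ γ = 0
          · simp [hν, hγ]
          · rw [heig γ hγ, hν]
            ring
      _ = c := by rw [hnorm, mul_one]
  have hupper : energy w ν ≤ 64 ^ 2 * ∑ i ∈ L, ∑ j ∈ L,
      (64 : ℝ) ^ i * (64 : ℝ) ^ j * ∑ α, w α * f i α * f j α := by
    calc energy w ν ≤ ∑ α, w α * (∑ i ∈ L, 64 * (64 : ℝ) ^ i * f i α) ^ 2 :=
          Finset.sum_le_sum fun α _ => mul_le_mul_of_nonneg_left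
            (pow_le_pow_left₀ (adjHardy_nonneg hν0 α) (hνf α) 2) (hw α)
      _ = ∑ α, ∑ i ∈ L, ∑ j ∈ L,
            64 ^ 2 * ((64 : ℝ) ^ i * (64 : ℝ) ^ j * (w α * f i α * f j α)) := by
          refine Finset.sum_congr rfl fun α _ => ?_
          rw [sq, Finset.sum_mul_sum, Finset.mul_sum]
          refine Finset.sum_congr rfl fun i _ => ?_
          rw [Finset.mul_sum]
          exact Finset.sum_congr rfl fun j _ => by ring
      _ = _ := by
          rw [Finset.sum_comm, Finset.mul_sum]
          refine Finset.sum_congr rfl fun i _ => ?_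
          rw [Finset.sum_comm, Finset.mul_sum]
          refine Finset.sum_congr rfl fun j _ => ?_
          rw [← Finset.mul_sum, ← Finset.mul_sum]
  have hone : ∑ i ∈ L, ∑ j ∈ L, (1 / 2 : ℝ) ^ (i - j).natAbs * e i ≤ 4 := by
    calc _ ≤ ∑ i ∈ L, 4 * e i := Finset.sum_le_sum fun i _ => by
          rw [← Finset.sum_mul]
          exact mul_le_mul_of_nonneg_right (sum_half_pow_natAbs_le L i) (he0 i)
      _ ≤ 4 := by
          rw [← Finset.mul_sum]
          linarith
  have htwo : ∑ i ∈ L, ∑ j ∈ L, (1 / 2 : ℝ) ^ (i - j).natAbs * e j ≤ 4 := by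
    rw [Finset.sum_comm]
    refine le_of_eq_of_le (Finset.sum_congr rfl fun i _ => Finset.sum_congr rfl fun j _ => ?_) hone
    rw [← Int.natAbs_neg, neg_sub]
  have hsum : ∑ i ∈ L, ∑ j ∈ L, (64 : ℝ) ^ i * (64 : ℝ) ^ j * ∑ α, w α * f i α * f j α ≤
      72 * s := by
    calc _ ≤ ∑ i ∈ L, ∑ j ∈ L, (9 * s * ((1 / 2 : ℝ) ^ (i - j).natAbs * e i) +
            9 * s * ((1 / 2 : ℝ) ^ (i - j).natAbs * e j)) :=
          Finset.sum_le_sum fun i _ => Finset.sum_le_sum fun j _ =>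
            (pair' i j).trans (le_of_eq (by ring))
      _ = 9 * s * ∑ i ∈ L, ∑ j ∈ L, (1 / 2 : ℝ) ^ (i - j).natAbs * e i +
            9 * s * ∑ i ∈ L, ∑ j ∈ L, (1 / 2 : ℝ) ^ (i - j).natAbs * e j := by
          simp only [Finset.sum_add_distrib, Finset.mul_sum]
      _ ≤ 9 * s * 4 + 9 * s * 4 := by gcongr
      _ = 72 * s := by ring
  have hcs : s ^ 6 ≤ 64 ^ 2 * 72 * s := by
    rw [hs6, ← henergy]
    linarith
  -- 64² · 72 = 294912 is below 13⁵ = 371293.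
  have hs13 : s ≤ 13 := by
    by_contra hcon
    push Not at hcon
    have h5 : (13 : ℝ) ^ 5 < s ^ 5 := pow_lt_pow_left₀ hcon (by norm_num) (by norm_num)
    have : s ^ 5 ≤ 64 ^ 2 * 72 := by
      refine le_of_mul_le_mul_right ?_ hs0
      rw [← pow_succ]
      exact hcs
    norm_num at h5 this
    linarith
  rw [← hs6]
  exact pow_le_pow_left₀ hs0.le hs13 6

theorem IsHereditaryBound.isEmbeddingBound
    (hk : ∀ s : ℝ, 0 < s → HasSmallTails fun α => s * w α)
    (hw : ∀ α, 0 ≤ w α) (hμ : ∀ α, 0 ≤ μ α) {h : ℝ} (h0 : 0 < h)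
    (hH : IsHereditaryBound w μ h) : IsEmbeddingBound w μ (13 ^ 6 * h) := by
  have hs0 : 0 < h⁻¹ := inv_pos.2 h0
  have hw' : ∀ α, 0 ≤ h⁻¹ * w α := fun α => mul_nonneg hs0.le (hw α)
  have H1 : IsHereditaryBound (fun α => h⁻¹ * w α) μ 1 := by
    refine ⟨zero_le_one, fun E => ?_⟩
    have := mul_le_mul_of_nonneg_left (hH.2 E) hs0.le
    rw [← mul_assoc, inv_mul_cancel₀ h0.ne', Finset.mul_sum] at this
    simpa only [mul_assoc] using this
  obtain ⟨C, hC, hCle⟩ : ∃ C, IsEmbeddingBound (fun α => h⁻¹ * w α) μ C ∧ C ≤ 13 ^ 6 := by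
    rcases exists_extremal hw' hμ with h1 | ⟨ψ, c, hc, hemb, hψ, heig, hnorm⟩
    · exact ⟨0, h1, by norm_num⟩
    · exact ⟨c, hemb, le_of_eigenfunction (hk _ hs0) hw' hμ H1 hc hψ heig hnorm⟩
  refine ⟨by positivity, fun ψ => ?_⟩
  have h1 := hC.2 ψ
  simp only [mul_assoc] at h1
  rw [← Finset.mul_sum, inv_mul_le_iff₀ h0] at h1
  refine h1.trans ?_
  rw [← mul_assoc, mul_comm h]
  exact mul_le_mul_of_nonneg_right (mul_le_mul_of_nonneg_right hCle h0.le)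
    (Finset.sum_nonneg fun ω _ => mul_nonneg (sq_nonneg _) (hμ ω))

end Embedding

/-! ### Assembling the theorem -/

theorem IsTensorProduct.const_mul {T₁ T₂ T₃ : Type*} {w : T₁ × T₂ × T₃ → ℝ}
    (h : IsTensorProduct w) {s : ℝ} (hs : 0 ≤ s) : IsTensorProduct fun α => s * w α := by
  obtain ⟨w₁, w₂, w₃, h₁, h₂, h₃, hw⟩ := h
  refine ⟨fun a => s * w₁ a, w₂, w₃, fun a => mul_nonneg hs (h₁ a), h₂, h₃, fun α => ?_⟩
  simp only [hw]
  ring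

end MultiTree

theorem theorem1p1 :
    ∃ K : ℝ, 0 < K ∧
      ∀ (T₁ T₂ T₃ : Type*) [Fintype T₁] [Fintype T₂] [Fintype T₃]
        [PartialOrder T₁] [PartialOrder T₂] [PartialOrder T₃],
        MultiTree.IsTree T₁ → MultiTree.IsTree T₂ → MultiTree.IsTree T₃ →
        ∀ μ w : T₁ × T₂ × T₃ → ℝ,
          (∀ α, 0 ≤ μ α) → (∀ α, 0 ≤ w α) → MultiTree.IsTensorProduct w →
            (MultiTree.boxConst w μ ≤ MultiTree.carlesonConst w μ ∧
              MultiTree.carlesonConst w μ ≤ MultiTree.hereditaryConst w μ ∧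
              MultiTree.hereditaryConst w μ ≤ MultiTree.embeddingConst w μ) ∧
            (MultiTree.embeddingConst w μ ≤ K * MultiTree.hereditaryConst w μ ∧
              MultiTree.hereditaryConst w μ ≤ K * MultiTree.carlesonConst w μ ∧
              MultiTree.carlesonConst w μ ≤ K * MultiTree.boxConst w μ) := by
  refine ⟨13 ^ 6 + MultiTree.boxFactor, add_pos (by norm_num) MultiTree.boxFactor_pos, ?_⟩
  intro T₁ T₂ T₃ _ _ _ _ _ _ hT₁ hT₂ hT₃ μ w hμ hw ht
  have hk : ∀ s : ℝ, 0 < s → MultiTree.HasSmallTails fun α => s * w α := fun s hs =>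
    MultiTree.hasSmallTails_of_isTensorProduct hT₁ hT₂ hT₃
      (fun α => mul_nonneg hs.le (hw α)) (ht.const_mul hs.le)
  have lB := MultiTree.isLeast_boxConst hw hμ
  have lC := MultiTree.isLeast_carlesonConst hw hμ
  have lH := MultiTree.isLeast_hereditaryConst hw hμ
  have lE := MultiTree.isLeast_embeddingConst hw hμ
  have hBC : MultiTree.boxConst w μ ≤ MultiTree.carlesonConst w μ := lB.2 lC.1.isBoxBound
  have hCH : MultiTree.carlesonConst w μ ≤ MultiTree.hereditaryConst w μ :=
    lC.2 (lH.1.isCarlesonBound hw)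
  have hHE : MultiTree.hereditaryConst w μ ≤ MultiTree.embeddingConst w μ :=
    lH.2 lE.1.isHereditaryBound
  have b0 : 0 ≤ MultiTree.boxConst w μ := lB.1.1
  have h0 : 0 ≤ MultiTree.hereditaryConst w μ := lH.1.1
  have hHB : MultiTree.hereditaryConst w μ ≤ MultiTree.boxFactor * MultiTree.boxConst w μ :=
    lH.2 (lB.1.isHereditaryBound hk hw hμ)
  have hEH : MultiTree.embeddingConst w μ ≤ 13 ^ 6 * MultiTree.hereditaryConst w μ := by
    -- The embedding bound normalises by a positive hereditary bound; since the constant may be 0,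
    -- it is enlarged by ε / 13⁶.
    refine le_of_forall_pos_le_add fun ε hε => ?_
    have hpos : 0 < MultiTree.hereditaryConst w μ + ε / 13 ^ 6 := by positivity
    have hb : MultiTree.IsHereditaryBound w μ (MultiTree.hereditaryConst w μ + ε / 13 ^ 6) := by
      refine ⟨hpos.le, fun E => (lH.1.2 E).trans (mul_le_mul_of_nonneg_right ?_
        (Finset.sum_nonneg fun α _ => hμ α))⟩
      have : 0 < ε / 13 ^ 6 := by positivity
      linarith
    refine (lE.2 (hb.isEmbeddingBound hk hw hμ hpos)).trans (le_of_eq ?_)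
    ring
  have hHB' : MultiTree.hereditaryConst w μ ≤
      (13 ^ 6 + MultiTree.boxFactor) * MultiTree.boxConst w μ := by
    rw [add_mul]
    have : 0 ≤ 13 ^ 6 * MultiTree.boxConst w μ := by positivity
    linarith
  have hK : 0 ≤ 13 ^ 6 + MultiTree.boxFactor :=
    add_nonneg (by norm_num) MultiTree.boxFactor_pos.le
  refine ⟨⟨hBC, hCH, hHE⟩, ?_, hHB'.trans (mul_le_mul_of_nonneg_left hBC hK), hCH.trans hHB'⟩
  rw [add_mul]
  have := mul_nonneg MultiTree.boxFactor_pos.le h0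
  linarith
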